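/- For positive integers $k_1,\dots,k_r$ with $k_r\ge 2$ (an admissible index of weight $k_1+\cdots+k_r$) let $$\zeta(k_1,\dots,k_r)=\sum_{0<n_1<\cdots<n_r}\frac{1}{n_1^{k_1}\cdots n_r^{k_r}}$$ be the (convergent) multiple zeta value. For $k\ge 2$ let $\mathbb I_k^{\mathrm{adm}}$ be the set of admissible indices of weight $k$, and let $\mathbb I_k^{\ge 2}\subset \mathbb I_k^{\mathrm{adm}}$ be the subset of those all of whose components are at least $2$. Define integers $c_{\boldsymbol k;\boldsymbol l}$ (for $\boldsymbol k\in\mathbb I_k^{\mathrm{adm}}$, $\boldsymbol l\in\mathbb I_k^{\ge2}$) as follows. Let $\mathbb Z\langle x,y\rangle$ be the ring of non-commutative polynomials. For every list $\boldsymbol c=(c_1,\dots,c_{2s})$ of positive integers of even length define $\mathfrak D(\boldsymbol c)\in\mathbb Z\langle x,y\rangle$ recursively by $\mathfrak D(\varnothing)=1$ and, for $s\ge1$, $$\begin{aligned} \mathfrak D(\boldsymbol c)={}&\sum_{\substack{(A,B)\in E(\boldsymbol c)\\ \#A+\#B\ge1}}(-1)^{\#B-1}\,\mathfrak D(\boldsymbol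 c_{(-A)}-\boldsymbol\delta_B)\,x^{\#A+\#B} +\sum_{\substack{(A,B)\in E(\boldsymbol c)\\ \#A+\#B\ge2}}(-1)^{\#B-1}\,\mathfrak D(\boldsymbol c_{(-A)}-\boldsymbol\delta_B)\,y\,x^{\#A+\#B-1}\\ &+\sum_{\substack{(A,B)\in O(\boldsymbol c)\\ \#A+\#B\ge2}}(-1)^{\#B}\,\mathfrak D(\boldsymbol c_{(-A)}-\boldsymbol\delta_B)\,y\,x^{\#A+\#B-1}. \end{aligned}$$ Here $E(\boldsymbol c)$ and $O(\boldsymbol c)$ are sets of pairs $(A,B)$ with $A\subset\{i : c_i=1\}$ and $B\subset\{i : c_i>1\}$ (sets of positions in $\{1,\dots,2s\}$). A pair belongs to $E(\boldsymbol c)$ if every even $i\in A$ has $i+1\in A$, every odd $i\in A$ has $i-1\in A$, and $\{2r,2r+1\}\not\subset B$ for $1\le r\le s-1$. It belongs to $O(\boldsymbol c)$ if every odd $i\in A$ has $i+1\in A$, every even $i\in A$ has $i-1\in A$, and $\{2r-1,2r\}\not\subset B$ for $1\le r\le s$. The list $\boldsymbol c_{(-A)}-\boldsymbol\delta_B$ is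 obtained from $\boldsymbol c$ by subtracting $1$ from the entries at the positions in $B$ and deleting the entries at the positions in $A$. Every $\boldsymbol k\in\mathbb I_k^{\mathrm{adm}}$ is uniquely of the form $(\{1\}^{c_1-1},c_2+1,\dots,\{1\}^{c_{2s-1}-1},c_{2s}+1)$ with positive integers $c_1,\dots,c_{2s}$, where $\{1\}^m$ denotes $1$ repeated $m$ times. Let $c_{\boldsymbol k;\boldsymbol l}$ be the coefficient in $\mathfrak D(c_1,\dots,c_{2s})$ of the word $e_{\boldsymbol l}=yx^{l_1-1}\cdots yx^{l_r-1}$, where $\boldsymbol l=(l_1,\dots,l_r)$. **Theorem.** Let $k\ge2$ be an integer. For every $\boldsymbol k\in\mathbb I_k^{\mathrm{adm}}$, corresponding to $(c_1,\dots,c_{2s})$, we have $\mathfrak D(c_1,\dots,c_{2s})=\sum_{\boldsymbol l\in\mathbb I_k^{\ge2}}c_{\boldsymbol k;\boldsymbol l}\,e_{\boldsymbol l}$ and $$\zeta(\boldsymbol k)=\sum_{\boldsymbol l\in\mathbb I_k^{\ge2}}c_{\boldsymbol k;\boldsymbol l}\,\zeta(\boldsymbol l).$$ In particular, $$\operatorname{span}_{\mathbb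 Z}\{\zeta(\boldsymbol k)\mid\boldsymbol k\in\mathbb I_k^{\mathrm{adm}}\}=\operatorname{span}_{\mathbb Z}\{\zeta(\boldsymbol k)\mid\boldsymbol k\in\mathbb I_k^{\ge2}\}.$$ -/

import Mathlib

namespace MZV

/-! ### Indices and multiple zeta values

An index of weight `k` is a composition of `k`; its list of components is `κ.blocks`. -/

/-- The summation range `0 < n₁ < ⋯ < n_r`. -/
abbrev Range (r : ℕ) : Type :=
  {n : Fin r → ℕ // (∀ i, 0 < n i) ∧ StrictMono n}

/-- The summand `1 / (n₁ ^ k₁ ⋯ n_r ^ k_r)`. -/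
noncomputable def term (k : List ℕ) (n : Range k.length) : ℝ :=
  ∏ i : Fin k.length, 1 / (n.1 i : ℝ) ^ k.get i

/-- The multiple zeta value `ζ(k₁, …, k_r)`. -/
noncomputable def zeta (k : List ℕ) : ℝ :=
  ∑' n : Range k.length, term k n

/-- The indices of weight `k` whose last component is at least `2`. -/
def admissible (k : ℕ) : Finset (Composition k) :=
  Finset.univ.filter fun κ => 2 ≤ κ.blocks.getLastD 0

/-- The admissible indices of weight `k` all of whose components are at least `2`. -/
def geTwo (k : ℕ) : Finset (Composition k) :=
  (admissible k).filter fun κ => ∀ i ∈ κ.blocks, 2 ≤ i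

/-! ### Non-commutative polynomials in `x` and `y` with integer coefficients -/

/-- The two non-commuting variables. -/
inductive Letter : Type
  | x
  | y
  deriving DecidableEq

/-- The ring `ℤ⟨x, y⟩`: finite `ℤ`-linear combinations of words in `x` and `y`. -/
abbrev Poly : Type := FreeRing Letter

/-- The variable `x` as a polynomial. -/
def X : Poly := FreeRing.of Letter.x

/-- The variable `y` as a polynomial. -/
def Y : Poly := FreeRing.of Letter.y

/-- The word `e_{k₁} ⋯ e_{k_r}`, where `e_k = y x ^ (k - 1)`. -/
def word (k : List ℕ) : FreeMonoid Letter :=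
  FreeMonoid.ofList (k.flatMap fun i => Letter.y :: List.replicate (i - 1) Letter.x)

/-- The coefficient of the word `w` in a polynomial. -/
def coeff (w : FreeMonoid Letter) : Poly →+ ℤ :=
  FreeAbelianGroup.lift fun v => if v.toList = w.toList then 1 else 0

/-! ### The recurrence

The positions in a list `c = (c₁, …, c_n)` are numbered `1, …, n`. -/

/-- The entry `c_i`, for `1 ≤ i ≤ n`. -/
def entry (c : List ℕ) (i : ℕ) : ℕ := c.getD (i - 1) 0

/-- The positions `i` with `c_i = 1`. -/
def ones (c : List ℕ) : Finset ℕ :=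
  (Finset.Icc 1 c.length).filter fun i => entry c i = 1

/-- The positions `i` with `c_i > 1`. -/
def big (c : List ℕ) : Finset ℕ :=
  (Finset.Icc 1 c.length).filter fun i => 1 < entry c i

/-- If an even `i` is in `A` then so is `i + 1`; if an odd `i` is in `A` then so is `i - 1`. -/
abbrev EvenOdd (A : Finset ℕ) : Prop :=
  ∀ i ∈ A, (Even i → i + 1 ∈ A) ∧ (Odd i → i - 1 ∈ A)

/-- If an odd `i` is in `A` then so is `i + 1`; if an even `i` is in `A` then so is `i - 1`. -/
abbrev OddEven (A : Finset ℕ) : Prop :=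
  ∀ i ∈ A, (Odd i → i + 1 ∈ A) ∧ (Even i → i - 1 ∈ A)

/-- Delete the entries at the positions in `A`, and subtract `1` from each remaining entry whose
(original) position is in `B`. -/
def reduce (c : List ℕ) (A B : Finset ℕ) : List ℕ :=
  ((List.range' 1 c.length).filter (· ∉ A)).map fun i => entry c i - if i ∈ B then 1 else 0

/-- The pairs `(A, B)` with `A` even-odd, `A` a set of positions of entries `= 1`, `B` a set of
positions of entries `> 1` with `{2r, 2r + 1} ⊄ B` for `1 ≤ r ≤ s - 1` where `2s` is the length
of `c`, and `#A + #B ≥ m`. -/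
def pairsEO (c : List ℕ) (m : ℕ) : Finset (Finset ℕ × Finset ℕ) :=
  ((ones c).powerset ×ˢ (big c).powerset).filter fun p =>
    EvenOdd p.1 ∧ m ≤ p.1.card + p.2.card ∧
      ∀ r ∈ Finset.Icc 1 (c.length / 2 - 1), ¬ {2 * r, 2 * r + 1} ⊆ p.2

/-- The pairs `(A, B)` with `A` odd-even, `A` a set of positions of entries `= 1`, `B` a set of
positions of entries `> 1` with `{2r - 1, 2r} ⊄ B` for `1 ≤ r ≤ s` where `2s` is the length
of `c`, and `#A + #B ≥ m`. -/
def pairsOE (c : List ℕ) (m : ℕ) : Finset (Finset ℕ × Finset ℕ) :=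
  ((ones c).powerset ×ˢ (big c).powerset).filter fun p =>
    OddEven p.1 ∧ m ≤ p.1.card + p.2.card ∧
      ∀ r ∈ Finset.Icc 1 (c.length / 2), ¬ {2 * r - 1, 2 * r} ⊆ p.2

theorem sum_filter_map_lt (l : List ℕ) (p : ℕ → Bool) (f g : ℕ → ℕ)
    (hle : ∀ i ∈ l, g i ≤ f i)
    (hlt : ∃ i ∈ l, (p i = false ∧ 0 < f i) ∨ g i < f i) :
    ((l.filter p).map g).sum < (l.map f).sum := by
  have key : ∀ l : List ℕ, (∀ i ∈ l, g i ≤ f i) → ((l.filter p).map g).sum ≤ (l.map f).sum := by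
    intro l
    induction l with
    | nil => simp
    | cons a t ih =>
      intro h
      have h1 := ih fun i hi => h i (List.mem_cons_of_mem _ hi)
      have h2 := h a List.mem_cons_self
      rw [List.filter_cons]
      split_ifs <;> simp <;> omega
  induction l with
  | nil => simp at hlt
  | cons a t ih =>
    have h1 := key t fun i hi => hle i (List.mem_cons_of_mem _ hi)
    have h2 := hle a List.mem_cons_self
    obtain ⟨i, hi, h⟩ := hlt
    rcases List.mem_cons.1 hi with rfl | hi
    · rw [List.filter_cons]
      split_ifs with hp
      · simp [hp] at h ⊢
        omega
      · simp
        omega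
    · have h3 := ih (fun i hi => hle i (List.mem_cons_of_mem _ hi)) ⟨i, hi, h⟩
      rw [List.filter_cons]
      split_ifs <;> simp <;> omega

theorem map_entry (c : List ℕ) : (List.range' 1 c.length).map (entry c) = c := by
  apply List.ext_getElem
  · simp
  · intro i h1 h2
    simp [entry, h2]

theorem reduce_sum_lt {c : List ℕ} {A B : Finset ℕ} (hA : A ⊆ ones c) (hB : B ⊆ big c)
    (h : 1 ≤ A.card + B.card) : (reduce c A B).sum < c.sum := by
  conv_rhs => rw [← map_entry c]
  apply sum_filter_map_lt
  · intro i _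
    exact Nat.sub_le _ _
  · rcases A.eq_empty_or_nonempty with rfl | ⟨i, hi⟩
    · have : B.Nonempty := by
        rw [← Finset.card_pos]
        simpa using h
      obtain ⟨i, hi⟩ := this
      have h2 := hB hi
      simp only [big, Finset.mem_filter, Finset.mem_Icc] at h2
      refine ⟨i, by rw [List.mem_range'_1]; omega, Or.inr ?_⟩
      simp only [hi, if_true]
      omega
    · have h2 := hA hi
      simp only [ones, Finset.mem_filter, Finset.mem_Icc] at h2
      refine ⟨i, by rw [List.mem_range'_1]; omega, Or.inl ⟨by simpa using hi, by omega⟩⟩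

theorem pairsEO_lt {c : List ℕ} {m : ℕ} (hm : 1 ≤ m) {p : Finset ℕ × Finset ℕ}
    (hp : p ∈ pairsEO c m) : (reduce c p.1 p.2).sum < c.sum := by
  simp only [pairsEO, Finset.mem_filter, Finset.mem_product, Finset.mem_powerset] at hp
  exact reduce_sum_lt hp.1.1 hp.1.2 (hm.trans hp.2.2.1)

theorem pairsOE_lt {c : List ℕ} {m : ℕ} (hm : 1 ≤ m) {p : Finset ℕ × Finset ℕ}
    (hp : p ∈ pairsOE c m) : (reduce c p.1 p.2).sum < c.sum := by
  simp only [pairsOE, Finset.mem_filter, Finset.mem_product, Finset.mem_powerset] at hp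
  exact reduce_sum_lt hp.1.1 hp.1.2 (hm.trans hp.2.2.1)

/-- The polynomial `𝔇(c₁, …, c_{2s})`, defined by recursion on `c₁ + ⋯ + c_{2s}`.  The sign
`(-1) ^ (#B - 1)` is written `(-1) ^ (#B + 1)`, as `#B` may be `0`. -/
def frakD : List ℕ → Poly
  | [] => 1
  | a :: t =>
    (∑ p ∈ (pairsEO (a :: t) 1).attach,
        (-1) ^ (p.1.2.card + 1) *
          (frakD (reduce (a :: t) p.1.1 p.1.2) * X ^ (p.1.1.card + p.1.2.card)))
    + (∑ p ∈ (pairsEO (a :: t) 2).attach,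
        (-1) ^ (p.1.2.card + 1) *
          (frakD (reduce (a :: t) p.1.1 p.1.2) * (Y * X ^ (p.1.1.card + p.1.2.card - 1))))
    + (∑ p ∈ (pairsOE (a :: t) 2).attach,
        (-1) ^ p.1.2.card *
          (frakD (reduce (a :: t) p.1.1 p.1.2) * (Y * X ^ (p.1.1.card + p.1.2.card - 1))))
  termination_by c => c.sum
  decreasing_by
    · exact pairsEO_lt (by norm_num) p.2
    · exact pairsEO_lt (by norm_num) p.2
    · exact pairsOE_lt (by norm_num) p.2

/-- Auxiliary function for `exponents`: `a` ones have been read since the last entry `≥ 2`. -/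
def exponentsAux (a : ℕ) : List ℕ → List ℕ
  | [] => []
  | m :: t => if m ≤ 1 then exponentsAux (a + 1) t else (a + 1) :: (m - 1) :: exponentsAux 0 t

/-- For an admissible index `k`, the list `(c₁, …, c_{2s})` of positive integers such that
`k = ({1}^{c₁ - 1}, c₂ + 1, …, {1}^{c_{2s-1} - 1}, c_{2s} + 1)`. -/
def exponents (k : List ℕ) : List ℕ := exponentsAux 0 k

/-- The integer `c_{k;l}`: the coefficient of `e_{l₁} ⋯ e_{l_r}` in `𝔇(c₁, …, c_{2s})`, where
`(c₁, …, c_{2s})` corresponds to `k`. -/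
def mzvCoeff (k l : List ℕ) : ℤ := coeff (word l) (frakD (exponents k))

end MZV

namespace MZV

/-! In the iterated integral for `ζ(k)`, the numbers `c₁, c₂, …` are the lengths of the alternating
runs of `dt/(1-t)` and `dt/t`. The finite sum `discreteIntegral N c` replaces it: runs carry weights
`1/(N-p)` and `1/q` alternately, with weak inequalities inside a run and from a `q` to the next `p`,
and strict ones from a `p` to the next `q`.

At level `N` the weak links between distinct runs join positions (2,3), (4,5), …. At level `N-1`,
after the translation `p ↦ p+1`, they join (1,2), (3,4), …. Where two linked runs meet at the same
`j`, the partial fraction `1/(j(N-j)) = (1/N)(1/j + 1/(N-j))` removes a letter from one of them.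
Hence the even-odd alternating sum at level `N` and the odd-even one at level `N-1`, both weighted
by `N^(-#A-#B)`, have the common value `contracted N c`: all links strict, and each run of length
one allowed to collapse to a factor `1/N` (`pairAlt_weakPair`, `altOE_discreteIntegral`,
`altEO_discreteIntegral`). This is a recurrence in `N`.

The definition of `frakD` is that recurrence written on words, so the truncated sums attached to
`frakD c` obey it too (`altEO_truncated`), and `truncated_eq_discreteIntegral` identifies the two at
every finite level. Only components at least 2 occur, since a new `y` always comes with `x^(m-1)`,
`m ≥ 2` (`frakD_mem_closure`).

It remains to let `N → ∞` (`tendsto_discreteIntegral`). With strict inequalities inside the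
`1/(N-p)` runs, the finite sum is exactly the truncated multiple zeta value (the
Maesaka–Seki–Watanabe formula), proved with the connector `C(m,n)/C(N,n)` in
`strictNested_exponents`. Passing from strict to weak costs a power of `log N` divided by `N`
(`exists_close`). -/

/-! ### Nested block operators in a ring -/

section BlockOperators

variable {A : Type*} [Ring A]

/-- A block of `c` letters of weight `w`, weakly ordered, where `σ` is the strict summation. -/
def block (σ w : A) (c : ℕ) : A := (w * (σ + 1)) ^ (c - 1) * w

/-- Two consecutive blocks, with the weak inequality between them. -/
def weakPair (σ v w : A) (a b : ℕ) : A := σ * block σ w b * ((σ + 1) * block σ v a)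

theorem block_one (σ w : A) : block σ w 1 = w := by simp [block]

theorem block_succ (σ w : A) (c : ℕ) :
    block σ w (c + 2) = w * ((σ + 1) * block σ w (c + 1)) := by
  simp [block, pow_succ', mul_assoc]

theorem block_succ' (σ w : A) (c : ℕ) :
    block σ w (c + 2) = block σ w (c + 1) * (σ + 1) * w := by
  simp [block, pow_succ, mul_assoc]

/-- The product over consecutive pairs of entries, later pairs on the left. -/
def chain (p : ℕ → ℕ → A) (e : ℕ → A) : List ℕ → A
  | [] => 1
  | [a] => e a
  | a :: b :: l => chain p e l * p a b

/-- The product of operators of two alternating kinds, later ones on the left. -/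
def alternating (p q : ℕ → A) : List ℕ → A
  | [] => 1
  | a :: l => alternating q p l * p a

theorem chain_congr {p p' : ℕ → ℕ → A} {e : ℕ → A}
    (h : ∀ a b, 1 ≤ a → 1 ≤ b → p a b = p' a b) :
    ∀ c : List ℕ, (∀ i ∈ c, 1 ≤ i) → chain p e c = chain p' e c
  | [], _ => rfl
  | [_], _ => rfl
  | a :: b :: l, hc => by
    rw [chain, chain, chain_congr h l fun i hi => hc i (by simp [hi]),
      h a b (hc _ (by simp)) (hc _ (by simp))]

theorem chain_eq_alternating {p q e : ℕ → A} :
    ∀ c : List ℕ, Even c.length → chain (fun a b => q b * p a) e c = alternating p q c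
  | [], _ => rfl
  | [_], h => by simp at h
  | a :: b :: l, h => by
    rw [chain, alternating, alternating, chain_eq_alternating l (by simpa [Nat.even_add] using h),
      mul_assoc]

/-- Regroups the pairs (1,2), (3,4), … as (2,3), (4,5), …, splitting off the first factor. -/
theorem chain_mul_eq {p q : ℕ → A} :
    ∀ (b : ℕ) (l : List ℕ), chain (fun b a => q a * p b) p (b :: l) =
      chain (fun a b => p b * q a) q l * p b
  | _, [] => by simp [chain]
  | _, [_] => by simp [chain]
  | b, a :: c :: l => by
    rw [chain, chain, chain_mul_eq c l]
    simp only [mul_assoc]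

variable [Algebra ℝ A]

/-- A strict block, where a block of one letter may be contracted at the cost of a factor `t`. -/
noncomputable def contractible (t : ℝ) (σ w : A) (c : ℕ) : A :=
  σ * block σ w c + if c = 1 then t • (1 : A) else 0

/-- The alternating combination attached to a single position. -/
noncomputable def singleAlt {M : Type*} [AddCommGroup M] [Module ℝ M] (t : ℝ) (e : ℕ → M) (a : ℕ) :
    M :=
  e a - if 1 < a then t • e (a - 1) else 0

/-- The alternating combination attached to two linked positions. -/
noncomputable def pairAlt (t : ℝ) (p : ℕ → ℕ → A) (a b : ℕ) : A :=
  p a b - (if 1 < a then t • p (a - 1) b else 0) - (if 1 < b then t • p a (b - 1) else 0) +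
    if a = 1 ∧ b = 1 then t ^ 2 • (1 : A) else 0

/-- Split the middle `σ + 1`. The part `σ` is the strict product. In the diagonal part the adjacent
letters `w * v` become `t • (v + w)`, which gives `t` times the two pairs with one block shortened;
these cancel the subtracted terms. A block of length one cannot be shortened, so its term survives
as a contraction, and the `t ^ 2` in `pairAlt` completes the product when both lengths are one. -/
theorem pairAlt_weakPair {t : ℝ} {σ v w : A} (h : w * v = t • (v + w)) {a b : ℕ} (ha : 1 ≤ a)
    (hb : 1 ≤ b) :
    pairAlt t (weakPair σ v w) a b = contractible t σ w b * contractible t σ v a := by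
  have key (p q : A) : p * w * (v * q) = t • (p * (v * q)) + t • (p * w * q) := by
    rw [mul_assoc, ← mul_assoc w, h, ← smul_add]
    simp [mul_add, add_mul, mul_assoc]
  rcases Nat.exists_eq_add_of_le' ha with ⟨a, rfl⟩
  rcases Nat.exists_eq_add_of_le' hb with ⟨b, rfl⟩
  have e : weakPair σ v w (a + 1) (b + 1) =
      σ * block σ w (b + 1) * (σ * block σ v (a + 1)) +
      σ * (block σ w (b + 1) * block σ v (a + 1)) := by
    simp [weakPair, add_mul, mul_add, mul_assoc]
  rw [pairAlt, e]
  rcases a with _ | a <;> rcases b with _ | b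
  · have := key 1 1
    simp only [one_mul, mul_one] at this
    simp only [contractible, zero_add, block_one, this]
    simp [mul_add, add_mul, smul_smul, pow_two]
    abel
  · have := key (block σ w (b + 1) * (σ + 1)) 1
    simp only [mul_one, ← block_succ'] at this
    simp only [contractible, zero_add, block_one, this, weakPair]
    simp [mul_add, add_mul, mul_assoc]
    abel
  · have := key 1 ((σ + 1) * block σ v (a + 1))
    simp only [one_mul, ← block_succ] at this
    simp only [contractible, zero_add, block_one, this, weakPair]
    simp [mul_add, add_mul, mul_assoc]
    abel
  · have := key (block σ w (b + 1) * (σ + 1)) ((σ + 1) * block σ v (a + 1))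
    simp only [← block_succ, ← block_succ'] at this
    simp only [contractible, this, weakPair]
    simp [mul_add, add_mul, mul_assoc]
    abel

end BlockOperators

/-! ### Alternating sums over linked pairs of sets of positions -/

/-- The translate by one of a set of positions. -/
def shift (A : Finset ℕ) : Finset ℕ := A.map (addRightEmbedding 1)

theorem succ_mem_shift {A : Finset ℕ} {i : ℕ} : i + 1 ∈ shift A ↔ i ∈ A := by
  simp [shift]

theorem zero_notMem_shift {A : Finset ℕ} : 0 ∉ shift A := by simp [shift]

theorem card_shift (A : Finset ℕ) : (shift A).card = A.card := by simp [shift]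

theorem sum_powerset_shift {M : Type*} [AddCommMonoid M] (s : Finset ℕ) (f : Finset ℕ → M) :
    ∑ A ∈ (shift s).powerset, f A = ∑ A ∈ s.powerset, f (shift A) := by
  symm
  refine Finset.sum_nbij shift ?_ ?_ ?_ fun _ _ => rfl
  · intro A hA
    simpa [shift] using hA
  · exact (Finset.map_injective _).injOn
  · intro A hA
    obtain ⟨B, hB, rfl⟩ := Finset.subset_map_iff.1 (Finset.mem_powerset.1 hA)
    exact ⟨B, by simpa using hB, rfl⟩

theorem entry_cons_succ (a : ℕ) (l : List ℕ) {i : ℕ} (hi : 1 ≤ i) :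
    entry (a :: l) (i + 1) = entry l i := by
  obtain ⟨i, rfl⟩ := Nat.exists_eq_add_of_le' hi
  simp [entry]

theorem filter_positions_cons (P : ℕ → Prop) [DecidablePred P] (a : ℕ) (l : List ℕ) :
    ((Finset.Icc 1 (a :: l).length).filter fun i => P (entry (a :: l) i)) =
      if P a then insert 1 (shift ((Finset.Icc 1 l.length).filter fun i => P (entry l i)))
      else shift ((Finset.Icc 1 l.length).filter fun i => P (entry l i)) := by
  ext i
  rcases i with _ | _ | i
  · split_ifs <;> simp [zero_notMem_shift]
  · have h0 : 0 ∉ (Finset.Icc 1 l.length).filter fun i => P (entry l i) := by simp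
    split_ifs with h
    · simpa [entry] using h
    · rw [succ_mem_shift]
      simpa [entry] using h
  · have h : entry (a :: l) (i + 1 + 1) = entry l (i + 1) := entry_cons_succ a l (by omega)
    split_ifs <;> simp [succ_mem_shift, h]

theorem sum_powerset_positions_cons {M : Type*} [AddCommMonoid M] (P : ℕ → Prop)
    [DecidablePred P] (a : ℕ) (l : List ℕ) (f : Finset ℕ → M) :
    ∑ A ∈ ((Finset.Icc 1 (a :: l).length).filter fun i => P (entry (a :: l) i)).powerset, f A =
      ∑ A ∈ ((Finset.Icc 1 l.length).filter fun i => P (entry l i)).powerset,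
        (f (shift A) + if P a then f (insert 1 (shift A)) else 0) := by
  rw [filter_positions_cons]
  split_ifs with h
  · rw [Finset.sum_powerset_insert, Finset.sum_add_distrib, sum_powerset_shift,
      sum_powerset_shift]
    rw [succ_mem_shift (i := 0)]
    simp
  · simp [sum_powerset_shift]

theorem sum_powerset_ones_cons {M : Type*} [AddCommMonoid M] (a : ℕ) (l : List ℕ)
    (f : Finset ℕ → M) :
    ∑ A ∈ (ones (a :: l)).powerset, f A =
      ∑ A ∈ (ones l).powerset, (f (shift A) + if a = 1 then f (insert 1 (shift A)) else 0) :=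
  sum_powerset_positions_cons (fun i => i = 1) a l f

theorem sum_powerset_big_cons {M : Type*} [AddCommMonoid M] (a : ℕ) (l : List ℕ)
    (f : Finset ℕ → M) :
    ∑ A ∈ (big (a :: l)).powerset, f A =
      ∑ A ∈ (big l).powerset, (f (shift A) + if 1 < a then f (insert 1 (shift A)) else 0) :=
  sum_powerset_positions_cons (fun i => 1 < i) a l f

theorem reduce_cons (a : ℕ) (l : List ℕ) {A A' B B' : Finset ℕ}
    (hA : ∀ i, 1 ≤ i → (i + 1 ∈ A' ↔ i ∈ A)) (hB : ∀ i, 1 ≤ i → (i + 1 ∈ B' ↔ i ∈ B)) :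
    reduce (a :: l) A' B' =
      (if 1 ∈ A' then [] else [a - if 1 ∈ B' then 1 else 0]) ++ reduce l A B := by
  have h : List.range' 1 (a :: l).length = 1 :: (List.range' 1 l.length).map (1 + ·) := by
    rw [List.map_add_range', List.length_cons, List.range'_succ]
  have h2 : (((List.range' 1 l.length).map (1 + ·)).filter (· ∉ A')).map
      (fun i => entry (a :: l) i - if i ∈ B' then 1 else 0) = reduce l A B := by
    rw [List.filter_map, List.map_map, reduce]
    rw [List.filter_congr (q := fun i => decide (i ∉ A))]
    · refine List.map_congr_left fun i hi => ?_
      have h1 : 1 ≤ i := by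
        have := List.mem_of_mem_filter hi
        rw [List.mem_range'_1] at this
        omega
      simp only [Function.comp, add_comm 1 i]
      rw [entry_cons_succ a l h1]
      simp only [hB i h1]
    · intro i hi
      rw [List.mem_range'_1] at hi
      simp only [Function.comp, add_comm 1 i, hA i hi.1]
  rw [reduce, h, List.filter_cons]
  by_cases h1 : 1 ∈ A'
  · simpa [h1] using h2
  · simp only [h1, not_false_eq_true, decide_true, if_true, List.map_cons, h2, if_false]
    simp [entry]

/-- The number 0 is not a position, but `shift` would turn it into position 1; hence the hypotheses.
-/
theorem reduce_shift_shift (a : ℕ) (l : List ℕ) {A B : Finset ℕ} (hA : 0 ∉ A) (hB : 0 ∉ B) :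
    reduce (a :: l) (shift A) (shift B) = a :: reduce l A B := by
  rw [reduce_cons a l (A := A) (B := B) (fun _ _ => succ_mem_shift) (fun _ _ => succ_mem_shift)]
  rw [if_neg (by rwa [succ_mem_shift (i := 0)]), if_neg (by rwa [succ_mem_shift (i := 0)])]
  simp

theorem reduce_shift_insert (a : ℕ) (l : List ℕ) {A B : Finset ℕ} (hA : 0 ∉ A) :
    reduce (a :: l) (shift A) (insert 1 (shift B)) = (a - 1) :: reduce l A B := by
  rw [reduce_cons a l (A := A) (B := B) (fun _ _ => succ_mem_shift)
    (fun i hi => by rw [Finset.mem_insert, succ_mem_shift]; simp; omega)]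
  rw [if_neg (by rwa [succ_mem_shift (i := 0)])]
  simp

theorem reduce_insert_shift (a : ℕ) (l : List ℕ) {A B : Finset ℕ} :
    reduce (a :: l) (insert 1 (shift A)) (shift B) = reduce l A B := by
  rw [reduce_cons a l (A := A) (B := B)
    (fun i hi => by rw [Finset.mem_insert, succ_mem_shift]; simp; omega)
    (fun _ _ => succ_mem_shift)]
  simp

theorem zero_notMem_of_mem_ones {c : List ℕ} {A : Finset ℕ} (h : A ∈ (ones c).powerset) :
    0 ∉ A := fun h0 => by
  have := Finset.mem_powerset.1 h h0
  simp [ones] at this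

theorem zero_notMem_of_mem_big {c : List ℕ} {A : Finset ℕ} (h : A ∈ (big c).powerset) :
    0 ∉ A := fun h0 => by
  have := Finset.mem_powerset.1 h h0
  simp [big] at this

theorem oddEven_shift_two {A A' : Finset ℕ} (h0 : 0 ∉ A') (hA : 0 ∉ A)
    (h : ∀ i, 1 ≤ i → (i + 2 ∈ A' ↔ i ∈ A)) :
    OddEven A' ↔ (1 ∈ A' ↔ 2 ∈ A') ∧ OddEven A := by
  constructor
  · intro H
    refine ⟨⟨fun h1 => (H 1 h1).1 (by decide), fun h2 => (H 2 h2).2 (by decide)⟩, ?_⟩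
    intro i hi
    have hi1 : 1 ≤ i := Nat.one_le_iff_ne_zero.2 fun h => hA (h ▸ hi)
    have H' := H (i + 2) ((h i hi1).2 hi)
    refine ⟨fun ho => ?_, fun he => ?_⟩
    · exact (h (i + 1) (by omega)).1 (H'.1 (by simpa [Nat.odd_add] using ho))
    · have hi2 : 1 ≤ i - 1 := by
        rcases he with ⟨k, rfl⟩
        omega
      have := H'.2 (by simpa [Nat.even_add] using he)
      rw [← h _ hi2]
      convert this using 1
      omega
  · rintro ⟨H12, H⟩ i hi
    rcases i with _ | _ | _ | i
    · exact absurd hi h0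
    · exact ⟨fun _ => H12.1 hi, fun h => absurd h (by decide)⟩
    · exact ⟨fun h => absurd h (by decide), fun _ => H12.2 hi⟩
    · have H' := H (i + 1) ((h (i + 1) (by omega)).1 hi)
      refine ⟨fun ho => ?_, fun he => ?_⟩
      · exact (h (i + 2) (by omega)).2 (H'.1 (by
          rw [Nat.odd_iff] at ho ⊢; omega))
      · have h1 := H'.2 (by rw [Nat.even_iff] at he ⊢; omega)
        have hi2 : 1 ≤ i := by
          rw [Nat.even_iff] at he; omega
        exact (h i hi2).2 h1

/-- Dropping one position exchanges parities and so the two kinds of links; position 1 is out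
because its partner would be 0. -/
theorem evenOdd_shift_one {A A' : Finset ℕ} (h0 : 0 ∉ A') (hA : 0 ∉ A)
    (h : ∀ i, 1 ≤ i → (i + 1 ∈ A' ↔ i ∈ A)) :
    EvenOdd A' ↔ 1 ∉ A' ∧ OddEven A := by
  constructor
  · intro H
    have h1 : 1 ∉ A' := fun h1 => h0 ((H 1 h1).2 (by decide))
    refine ⟨h1, ?_⟩
    intro i hi
    have hi1 : 1 ≤ i := Nat.one_le_iff_ne_zero.2 fun h => hA (h ▸ hi)
    have H' := H (i + 1) ((h i hi1).2 hi)
    refine ⟨fun ho => ?_, fun he => ?_⟩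
    · exact (h (i + 1) (by omega)).1 (H'.1 (by rw [Nat.odd_iff] at ho; rw [Nat.even_iff]; omega))
    · have hi2 : 1 ≤ i - 1 := by
        rcases he with ⟨k, rfl⟩
        omega
      have := H'.2 (by rw [Nat.even_iff] at he; rw [Nat.odd_iff]; omega)
      rw [← h _ hi2]
      convert this using 1
      omega
  · rintro ⟨H1, H⟩ i hi
    rcases i with _ | _ | i
    · exact absurd hi h0
    · exact absurd hi H1
    · have H' := H (i + 1) ((h (i + 1) (by omega)).1 hi)
      refine ⟨fun ho => ?_, fun he => ?_⟩
      · exact (h (i + 2) (by omega)).2 (H'.1 (by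
          rw [Nat.even_iff] at ho; rw [Nat.odd_iff]; omega))
      · have h1 := H'.2 (by rw [Nat.odd_iff] at he; rw [Nat.even_iff]; omega)
        have hi2 : 1 ≤ i := by
          rw [Nat.odd_iff] at he; omega
        exact (h i hi2).2 h1

theorem pair_unlinked_shift_two {n : ℕ} {B B' : Finset ℕ}
    (h : ∀ i, 1 ≤ i → (i + 2 ∈ B' ↔ i ∈ B)) :
    (∀ r ∈ Finset.Icc 1 ((n + 2) / 2), ¬ {2 * r - 1, 2 * r} ⊆ B') ↔
      ¬ (1 ∈ B' ∧ 2 ∈ B') ∧ ∀ r ∈ Finset.Icc 1 (n / 2), ¬ {2 * r - 1, 2 * r} ⊆ B := by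
  simp only [Finset.insert_subset_iff, Finset.singleton_subset_iff, Finset.mem_Icc]
  constructor
  · refine fun H => ⟨H 1 (by omega), fun r hr => ?_⟩
    have := H (r + 1) (by omega)
    rwa [← h _ (by omega), ← h _ (by omega), show 2 * r - 1 + 2 = 2 * (r + 1) - 1 by omega,
      show 2 * r + 2 = 2 * (r + 1) by omega]
  · rintro ⟨H1, H⟩ r hr
    rcases r with _ | _ | r
    · omega
    · exact H1
    · have := H (r + 1) (by omega)
      rwa [← h _ (by omega), ← h _ (by omega),
        show 2 * (r + 1) - 1 + 2 = 2 * (r + 1 + 1) - 1 by omega,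
        show 2 * (r + 1) + 2 = 2 * (r + 1 + 1) by omega] at this

theorem pair_unlinked_shift_one {n : ℕ} (hn : Odd n) {B B' : Finset ℕ}
    (h : ∀ i, 1 ≤ i → (i + 1 ∈ B' ↔ i ∈ B)) :
    (∀ r ∈ Finset.Icc 1 ((n + 1) / 2 - 1), ¬ {2 * r, 2 * r + 1} ⊆ B') ↔
      ∀ r ∈ Finset.Icc 1 (n / 2), ¬ {2 * r - 1, 2 * r} ⊆ B := by
  have : (n + 1) / 2 - 1 = n / 2 := by
    rw [Nat.odd_iff] at hn; omega
  rw [this]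
  refine forall₂_congr fun r hr => ?_
  rw [Finset.mem_Icc] at hr
  simp only [Finset.insert_subset_iff, Finset.singleton_subset_iff]
  rw [← h _ (by omega), ← h _ (by omega), show 2 * r - 1 + 1 = 2 * r by omega]

section AlternatingSums

variable {M : Type*} [AddCommGroup M] [Module ℝ M]

/-- The alternating sum over the pairs with `A` even-odd. -/
noncomputable def altEO (t : ℝ) (Ψ : List ℕ → M) (c : List ℕ) : M :=
  ∑ p ∈ pairsEO c 0,
    ((-1) ^ p.2.card * t ^ (p.1.card + p.2.card) : ℝ) • Ψ (reduce c p.1 p.2)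

/-- The alternating sum over the pairs with `A` odd-even. -/
noncomputable def altOE (t : ℝ) (Ψ : List ℕ → M) (c : List ℕ) : M :=
  ∑ p ∈ pairsOE c 0,
    ((-1) ^ p.2.card * t ^ (p.1.card + p.2.card) : ℝ) • Ψ (reduce c p.1 p.2)

theorem altEO_eq (t : ℝ) (Ψ : List ℕ → M) (c : List ℕ) :
    altEO t Ψ c = ∑ A ∈ (ones c).powerset, ∑ B ∈ (big c).powerset,
      if EvenOdd A ∧ ∀ r ∈ Finset.Icc 1 (c.length / 2 - 1), ¬ {2 * r, 2 * r + 1} ⊆ B then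
        ((-1) ^ B.card * t ^ (A.card + B.card) : ℝ) • Ψ (reduce c A B) else 0 := by
  simp only [altEO, pairsEO, Finset.sum_filter, Finset.sum_product, zero_le, true_and]

theorem altOE_eq (t : ℝ) (Ψ : List ℕ → M) (c : List ℕ) :
    altOE t Ψ c = ∑ A ∈ (ones c).powerset, ∑ B ∈ (big c).powerset,
      if OddEven A ∧ ∀ r ∈ Finset.Icc 1 (c.length / 2), ¬ {2 * r - 1, 2 * r} ⊆ B then
        ((-1) ^ B.card * t ^ (A.card + B.card) : ℝ) • Ψ (reduce c A B) else 0 := by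
  simp only [altOE, pairsOE, Finset.sum_filter, Finset.sum_product, zero_le, true_and]

/-- The term of `altOE` at a pair of sets. -/
noncomputable def termOE (t : ℝ) (Ψ : List ℕ → M) (c : List ℕ) (A B : Finset ℕ) : M :=
  if OddEven A ∧ ∀ r ∈ Finset.Icc 1 (c.length / 2), ¬ {2 * r - 1, 2 * r} ⊆ B then
    ((-1) ^ B.card * t ^ (A.card + B.card) : ℝ) • Ψ (reduce c A B) else 0

theorem altOE_eq_sum_termOE (t : ℝ) (Ψ : List ℕ → M) (c : List ℕ) :
    altOE t Ψ c = ∑ A ∈ (ones c).powerset, ∑ B ∈ (big c).powerset, termOE t Ψ c A B :=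
  altOE_eq t Ψ c

theorem one_notMem_shift {A : Finset ℕ} (hA : 0 ∉ A) : 1 ∉ shift A := by
  rwa [succ_mem_shift (i := 0)]

theorem two_notMem_shift_shift {A : Finset ℕ} (hA : 0 ∉ A) : 2 ∉ shift (shift A) := by
  rwa [succ_mem_shift (i := 1), succ_mem_shift (i := 0)]

theorem card_insert_shift (A : Finset ℕ) (hA : 0 ∉ A) :
    (insert 1 (shift A)).card = A.card + 1 := by
  rw [Finset.card_insert_of_notMem (one_notMem_shift hA), card_shift]

theorem zero_notMem_insert_shift (A : Finset ℕ) : 0 ∉ insert 1 (shift A) := by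
  simp [zero_notMem_shift]

/-! ### The possible choices at the first two, linked, positions. -/

section Pairs

variable (t : ℝ) (Ψ : List ℕ → M) (a b : ℕ) (l : List ℕ) {A B : Finset ℕ}

theorem termOE_of_not_iff {A' B' : Finset ℕ} (h : ¬ (1 ∈ A' ↔ 2 ∈ A')) :
    termOE t Ψ (a :: b :: l) A' B' = 0 := by
  refine if_neg fun H => h ⟨fun h1 => (H.1 1 h1).1 (by decide), fun h2 => (H.1 2 h2).2 (by decide)⟩

theorem termOE_of_linked {A' B' : Finset ℕ} (h1 : 1 ∈ B') (h2 : 2 ∈ B') :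
    termOE t Ψ (a :: b :: l) A' B' = 0 := by
  refine if_neg fun H => H.2 1 (by simp; omega) ?_
  simp [Finset.insert_subset_iff, h1, h2]

/-- Common form of the surviving choices: `m` counts the deleted and `n` the lowered entries among
the first two, and these contribute `(-1) ^ n * t ^ (m + n)`. -/
theorem termOE_shift {A' B' : Finset ℕ} (hA : 0 ∉ A) (h0 : 0 ∉ A')
    (hAA : ∀ i, 1 ≤ i → (i + 2 ∈ A' ↔ i ∈ A)) (hBB : ∀ i, 1 ≤ i → (i + 2 ∈ B' ↔ i ∈ B))
    (h : 1 ∈ A' ↔ 2 ∈ A') (h' : ¬ (1 ∈ B' ∧ 2 ∈ B')) {m n : ℕ} (hm : A'.card = A.card + m)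
    (hn : B'.card = B.card + n) {Φ : List ℕ → M}
    (hΦ : Ψ (reduce (a :: b :: l) A' B') = Φ (reduce l A B)) :
    termOE t Ψ (a :: b :: l) A' B' = ((-1) ^ n * t ^ (m + n) : ℝ) • termOE t Φ l A B := by
  have e : OddEven A' ∧ (∀ r ∈ Finset.Icc 1 ((a :: b :: l).length / 2), ¬ {2 * r - 1, 2 * r} ⊆ B')
      ↔ OddEven A ∧ ∀ r ∈ Finset.Icc 1 (l.length / 2), ¬ {2 * r - 1, 2 * r} ⊆ B := by
    rw [oddEven_shift_two h0 hA hAA]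
    have := pair_unlinked_shift_two (n := l.length) hBB
    rw [List.length_cons, List.length_cons, this]
    tauto
  rw [termOE, termOE]
  simp only [e, hΦ, hm, hn]
  split_ifs
  · rw [smul_smul]
    congr 1
    ring
  · simp

theorem termOE_keep_keep (hA : 0 ∉ A) (hB : 0 ∉ B) :
    termOE t Ψ (a :: b :: l) (shift (shift A)) (shift (shift B)) =
      termOE t (fun c => Ψ (a :: b :: c)) l A B := by
  rw [termOE_shift t Ψ a b l (A := A) (B := B) (m := 0) (n := 0) hA zero_notMem_shift
    (fun _ _ => by rw [succ_mem_shift, succ_mem_shift])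
    (fun _ _ => by rw [succ_mem_shift, succ_mem_shift])
    (iff_of_false (one_notMem_shift zero_notMem_shift) (two_notMem_shift_shift hA))
    (fun h => one_notMem_shift zero_notMem_shift h.1) (by simp [card_shift]) (by simp [card_shift])
    (Φ := fun c => Ψ (a :: b :: c))]
  · simp
  · rw [reduce_shift_shift _ _ zero_notMem_shift zero_notMem_shift, reduce_shift_shift _ _ hA hB]

theorem termOE_lower_keep (hA : 0 ∉ A) (hB : 0 ∉ B) :
    termOE t Ψ (a :: b :: l) (shift (shift A)) (insert 1 (shift (shift B))) =
      -(t • termOE t (fun c => Ψ ((a - 1) :: b :: c)) l A B) := by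
  rw [termOE_shift t Ψ a b l (A := A) (B := B) (m := 0) (n := 1) hA zero_notMem_shift
    (fun _ _ => by rw [succ_mem_shift, succ_mem_shift])
    (fun _ _ => by rw [Finset.mem_insert, succ_mem_shift, succ_mem_shift]; simp)
    (iff_of_false (one_notMem_shift zero_notMem_shift) (two_notMem_shift_shift hA))
    (fun h => two_notMem_shift_shift hB (by simpa using h.2)) (by simp [card_shift])
    (by rw [card_insert_shift _ zero_notMem_shift, card_shift])
    (Φ := fun c => Ψ ((a - 1) :: b :: c))]
  · simp
  · rw [reduce_shift_insert _ _ zero_notMem_shift, reduce_shift_shift _ _ hA hB]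

theorem termOE_keep_lower (hA : 0 ∉ A) (hB : 0 ∉ B) :
    termOE t Ψ (a :: b :: l) (shift (shift A)) (shift (insert 1 (shift B))) =
      -(t • termOE t (fun c => Ψ (a :: (b - 1) :: c)) l A B) := by
  rw [termOE_shift t Ψ a b l (A := A) (B := B) (m := 0) (n := 1) hA zero_notMem_shift
    (fun _ _ => by rw [succ_mem_shift, succ_mem_shift])
    (fun i hi => by rw [succ_mem_shift, Finset.mem_insert, succ_mem_shift]; simp; omega)
    (iff_of_false (one_notMem_shift zero_notMem_shift) (two_notMem_shift_shift hA))
    (fun h => one_notMem_shift (zero_notMem_insert_shift B) h.1) (by simp [card_shift])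
    (by rw [card_shift, card_insert_shift _ hB])
    (Φ := fun c => Ψ (a :: (b - 1) :: c))]
  · simp
  · rw [reduce_shift_shift _ _ zero_notMem_shift (zero_notMem_insert_shift B),
      reduce_shift_insert _ _ hA]

theorem termOE_delete_delete (hA : 0 ∉ A) :
    termOE t Ψ (a :: b :: l) (insert 1 (shift (insert 1 (shift A)))) (shift (shift B)) =
      t ^ 2 • termOE t Ψ l A B := by
  rw [termOE_shift t Ψ a b l (A := A) (B := B) (m := 2) (n := 0) hA (zero_notMem_insert_shift _)
    (fun i hi => by
      rw [Finset.mem_insert, succ_mem_shift, Finset.mem_insert, succ_mem_shift]; simp; omega)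
    (fun _ _ => by rw [succ_mem_shift, succ_mem_shift])
    (iff_of_true (by simp) (by simp [succ_mem_shift (i := 1)]))
    (fun h => one_notMem_shift zero_notMem_shift h.1)
    (by rw [card_insert_shift _ (zero_notMem_insert_shift A), card_insert_shift _ hA])
    (by simp [card_shift]) (Φ := Ψ)]
  · simp
  · rw [reduce_insert_shift, reduce_insert_shift]

/-- At a linked pair one may keep both entries, lower one of them, or delete both. Deleting just one
is not odd-even, lowering both is forbidden, and an entry that is 1 cannot be lowered. -/
theorem altOE_cons_cons :
    altOE t Ψ (a :: b :: l) = altOE t (fun c => Ψ (a :: b :: c)) l -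
      (if 1 < a then t • altOE t (fun c => Ψ ((a - 1) :: b :: c)) l else 0) -
      (if 1 < b then t • altOE t (fun c => Ψ (a :: (b - 1) :: c)) l else 0) +
      if a = 1 ∧ b = 1 then t ^ 2 • altOE t Ψ l else 0 := by
  have h : ∀ A ∈ (ones l).powerset, ∀ B ∈ (big l).powerset, _ := fun A hA B hB =>
    And.intro (termOE_keep_keep t Ψ a b l (zero_notMem_of_mem_ones hA) (zero_notMem_of_mem_big hB))
    (And.intro
      (termOE_lower_keep t Ψ a b l (zero_notMem_of_mem_ones hA) (zero_notMem_of_mem_big hB))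
    (And.intro
      (termOE_keep_lower t Ψ a b l (zero_notMem_of_mem_ones hA) (zero_notMem_of_mem_big hB))
      (termOE_delete_delete t Ψ a b l (B := B) (zero_notMem_of_mem_ones hA))))
  simp only [altOE_eq_sum_termOE, sum_powerset_ones_cons, sum_powerset_big_cons]
  have key : ∀ A ∈ (ones l).powerset, ∀ B ∈ (big l).powerset,
      (((termOE t Ψ (a :: b :: l) (shift (shift A)) (shift (shift B)) +
        if 1 < a then termOE t Ψ (a :: b :: l) (shift (shift A)) (insert 1 (shift (shift B)))
          else 0) +
        if 1 < b then (termOE t Ψ (a :: b :: l) (shift (shift A)) (shift (insert 1 (shift B))) +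
          if 1 < a then termOE t Ψ (a :: b :: l) (shift (shift A))
            (insert 1 (shift (insert 1 (shift B)))) else 0) else 0)) =
      termOE t (fun c => Ψ (a :: b :: c)) l A B -
      (if 1 < a then t • termOE t (fun c => Ψ ((a - 1) :: b :: c)) l A B else 0) -
      (if 1 < b then t • termOE t (fun c => Ψ (a :: (b - 1) :: c)) l A B else 0) := by
    intro A hA B hB
    obtain ⟨h1, h2, h3, h4⟩ := h A hA B hB
    rw [h1, h2, h3, termOE_of_linked t Ψ a b l (by simp) (by simp [succ_mem_shift (i := 1)])]
    split_ifs <;> simp [sub_eq_add_neg]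
  have key2 : ∀ A ∈ (ones l).powerset, ∀ B : Finset ℕ,
      termOE t Ψ (a :: b :: l) (insert 1 (shift (shift A))) B = 0 ∧
      termOE t Ψ (a :: b :: l) (shift (insert 1 (shift A))) B = 0 := by
    intro A hA B
    have hA0 := zero_notMem_of_mem_ones hA
    refine ⟨termOE_of_not_iff t Ψ a b l ?_, termOE_of_not_iff t Ψ a b l ?_⟩
    · simp [two_notMem_shift_shift hA0]
    · simp [succ_mem_shift (i := 0), succ_mem_shift (i := 1), zero_notMem_shift]
  trans ∑ A ∈ (ones l).powerset, ((∑ B ∈ (big l).powerset,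
      (termOE t (fun c => Ψ (a :: b :: c)) l A B -
      (if 1 < a then t • termOE t (fun c => Ψ ((a - 1) :: b :: c)) l A B else 0) -
      (if 1 < b then t • termOE t (fun c => Ψ (a :: (b - 1) :: c)) l A B else 0))) +
      if a = 1 ∧ b = 1 then t ^ 2 • ∑ B ∈ (big l).powerset, termOE t Ψ l A B else 0)
  · refine Finset.sum_congr rfl fun A hA => ?_
    rw [Finset.sum_congr rfl (key A hA)]
    simp only [key2 A hA]
    by_cases ha : a = 1
    · by_cases hb : b = 1
      · have h4 := fun B hB => (h A hA B hB).2.2.2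
        simp [ha, hb] at h4 ⊢
        rw [Finset.smul_sum]
        exact Finset.sum_congr rfl fun B hB => h4 B (Finset.mem_powerset.1 hB)
      · simp [hb]
    · simp [ha]
  · split_ifs <;> simp [Finset.smul_sum, Finset.sum_sub_distrib, Finset.sum_add_distrib]

end Pairs

theorem altOE_nil (t : ℝ) (Ψ : List ℕ → M) : altOE t Ψ [] = Ψ [] := by
  simp [altOE_eq, ones, big, reduce]

/-- An unpaired last entry can be lowered but never deleted, as its partner is missing. -/
theorem altOE_singleton (t : ℝ) (Ψ : List ℕ → M) (a : ℕ) :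
    altOE t Ψ [a] = singleAlt t (fun i => Ψ [i]) a := by
  have h1 : ones ([] : List ℕ) = ∅ := rfl
  have h2 : big ([] : List ℕ) = ∅ := rfl
  have h3 : shift ∅ = ∅ := rfl
  have h4 : ¬ OddEven {1} := fun h => by simpa using (h 1 (by simp)).1 (by decide)
  have h5 := reduce_shift_insert a [] (A := ∅) (B := ∅) (by simp)
  have h6 := reduce_shift_shift a [] (A := ∅) (B := ∅) (by simp) (by simp)
  rw [altOE_eq, sum_powerset_ones_cons, h1, Finset.powerset_empty, Finset.sum_singleton,
    sum_powerset_big_cons, sum_powerset_big_cons, h2]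
  simp only [Finset.powerset_empty, Finset.sum_singleton, h3] at h5 h6 ⊢
  simp only [insert_empty_eq] at h5 ⊢
  simp only [h4, singleAlt, reduce]
  simp only [false_and, if_false]
  split_ifs <;> simp_all [sub_eq_add_neg, entry]

/-- The first position has no even-odd partner, so it is kept or lowered; after renumbering, the
links among the others are odd-even. -/
theorem altEO_cons (t : ℝ) (Ψ : List ℕ → M) (a : ℕ) {l : List ℕ} (hl : Odd l.length) :
    altEO t Ψ (a :: l) = altOE t (fun c => Ψ (a :: c)) l -
      if 1 < a then t • altOE t (fun c => Ψ ((a - 1) :: c)) l else 0 := by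
  have key : ∀ A ∈ (ones l).powerset, ∀ B ∈ (big l).powerset, ∀ B' : Finset ℕ, ∀ n : ℕ,
      ∀ Φ : List ℕ → M, (∀ i, 1 ≤ i → (i + 1 ∈ B' ↔ i ∈ B)) → B'.card = B.card + n →
      Ψ (reduce (a :: l) (shift A) B') = Φ (reduce l A B) →
      (if EvenOdd (shift A) ∧ ∀ r ∈ Finset.Icc 1 ((a :: l).length / 2 - 1),
          ¬ {2 * r, 2 * r + 1} ⊆ B' then
        ((-1) ^ B'.card * t ^ ((shift A).card + B'.card) : ℝ) • Ψ (reduce (a :: l) (shift A) B')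
        else 0) = ((-1) ^ n * t ^ n : ℝ) • termOE t Φ l A B := by
    intro A hA B hB B' n Φ hBB hn hΦ
    have hA0 := zero_notMem_of_mem_ones hA
    have e1 := evenOdd_shift_one zero_notMem_shift hA0 fun _ _ => succ_mem_shift
    have e2 := pair_unlinked_shift_one hl hBB
    rw [← List.length_cons (a := a)] at e2
    simp only [one_notMem_shift hA0, not_false_eq_true, true_and] at e1
    simp only [e1, e2, hΦ, hn, card_shift, termOE]
    split_ifs
    · rw [smul_smul]
      congr 1
      ring
    · simp
  have key2 : ∀ A B : Finset ℕ, ¬ EvenOdd (insert 1 (shift A)) := fun A B H =>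
    zero_notMem_insert_shift A ((H 1 (by simp)).2 (by decide))
  simp only [altEO_eq, altOE_eq_sum_termOE, sum_powerset_ones_cons, sum_powerset_big_cons]
  trans ∑ A ∈ (ones l).powerset, ∑ B ∈ (big l).powerset,
      (termOE t (fun c => Ψ (a :: c)) l A B -
      if 1 < a then t • termOE t (fun c => Ψ ((a - 1) :: c)) l A B else 0)
  · refine Finset.sum_congr rfl fun A hA => ?_
    simp only [key2 A A, false_and, if_false, ite_self, add_zero, Finset.sum_const_zero]
    refine Finset.sum_congr rfl fun B hB => ?_
    have hA0 := zero_notMem_of_mem_ones hA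
    have hB0 := zero_notMem_of_mem_big hB
    rw [key A hA B hB (shift B) 0 (fun c => Ψ (a :: c)) (fun _ _ => succ_mem_shift) (card_shift B)
        (by rw [reduce_shift_shift _ _ hA0 hB0]),
      key A hA B hB (insert 1 (shift B)) 1 (fun c => Ψ ((a - 1) :: c))
        (fun _ _ => by rw [Finset.mem_insert, succ_mem_shift]; simp; omega)
        (card_insert_shift B hB0) (by rw [reduce_shift_insert _ _ hA0])]
    split_ifs <;> simp [sub_eq_add_neg]
  · split_ifs <;> simp [Finset.smul_sum, Finset.sum_sub_distrib]

variable {A : Type*} [Ring A] [Algebra ℝ A]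

theorem altOE_map {N : Type*} [AddCommGroup N] [Module ℝ N] (φ : M →ₗ[ℝ] N) (t : ℝ)
    (Ψ : List ℕ → M) (c : List ℕ) :
    altOE t (fun c => φ (Ψ c)) c = φ (altOE t Ψ c) := by
  simp [altOE, map_sum]

/-- The choices at different linked pairs are independent, so the alternating sum of a product is
the product of the alternating combinations. -/
theorem altOE_chain (t : ℝ) (p : ℕ → ℕ → A) (e : ℕ → A) :
    ∀ c : List ℕ, altOE t (chain p e) c = chain (pairAlt t p) (singleAlt t e) c
  | [] => altOE_nil t _
  | [a] => altOE_singleton t _ a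
  | a :: b :: l => by
    have h (u : A) : altOE t (fun c => chain p e c * u) l =
        chain (pairAlt t p) (singleAlt t e) l * u := by
      rw [← altOE_chain t p e l]
      exact altOE_map (LinearMap.mulRight ℝ u) t (chain p e) l
    rw [altOE_cons_cons]
    simp only [chain, h, altOE_chain t p e l]
    rw [pairAlt, mul_add, mul_sub, mul_sub]
    congr 1
    · congr 1
      · congr 1
        split_ifs <;> simp
      · split_ifs <;> simp
    · split_ifs <;> simp

end AlternatingSums

/-! ### Operators on sequences -/

/-- Operators on real sequences. -/
abbrev SeqOp : Type := Module.End ℝ (ℕ → ℝ)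

/-- Strict partial sums. -/
def partialSum : SeqOp where
  toFun g m := ∑ j ∈ Finset.range m, g j
  map_add' g h := by
    ext m
    simp [Finset.sum_add_distrib]
  map_smul' r g := by
    ext m
    simp [Finset.mul_sum]

/-- Multiplication by a weight. -/
def weight (w : ℕ → ℝ) : SeqOp where
  toFun g m := w m * g m
  map_add' g h := by
    ext m
    simp [mul_add]
  map_smul' r g := by
    ext m
    simp [mul_left_comm]

/-- Evaluation of a sequence at a place. -/
def evalAt (n : ℕ) : (ℕ → ℝ) →ₗ[ℝ] ℝ := LinearMap.proj n

theorem partialSum_apply (g : ℕ → ℝ) (m : ℕ) : partialSum g m = ∑ j ∈ Finset.range m, g j := rfl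

theorem partialSum_add_one_apply (g : ℕ → ℝ) (m : ℕ) :
    (partialSum + 1) g m = ∑ j ∈ Finset.range (m + 1), g j := by
  simp [partialSum_apply, Finset.sum_range_succ]

theorem weight_apply (w g : ℕ → ℝ) (m : ℕ) : weight w g m = w m * g m := rfl

theorem block_apply_succ (σ w : SeqOp) (c : ℕ) (g : ℕ → ℝ) :
    block σ w (c + 2) g = w ((σ + 1) (block σ w (c + 1) g)) := by
  rw [block_succ]
  rfl

/-- The weights `1 / j`. -/
noncomputable def recip (j : ℕ) : ℝ := 1 / j

/-- The weights `1 / (N - j)`. -/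
noncomputable def corecip (N j : ℕ) : ℝ := 1 / ((N : ℝ) - j)

/-- The restriction of a weight to the open interval from `0` to `N`. -/
noncomputable def interior (N : ℕ) (w : ℕ → ℝ) (j : ℕ) : ℝ := if 0 < j ∧ j < N then w j else 0

/-- The discretized iterated integral, as an operator. -/
noncomputable def nested (N : ℕ) : List ℕ → SeqOp :=
  chain (fun b a => (partialSum + 1) * block partialSum (weight recip) a *
    (partialSum * block partialSum (weight (corecip N)) b))
    fun b => partialSum * block partialSum (weight (corecip N)) b

/-- The discretized iterated integral. -/
noncomputable def discreteIntegral (N : ℕ) (c : List ℕ) : ℝ := nested N c 1 N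

/-- The cut to `0 < j < N` is essential: with `1 / 0 = 0` the partial fraction identity fails at
both endpoints. -/
theorem interior_mul (N : ℕ) (hN : 1 ≤ N) :
    weight (interior N recip) * weight (interior N (corecip N)) =
      (1 / N : ℝ) • (weight (interior N (corecip N)) + weight (interior N recip)) := by
  ext g j
  simp only [Module.End.mul_apply, weight_apply, LinearMap.smul_apply, LinearMap.add_apply,
    Pi.smul_apply, Pi.add_apply, smul_eq_mul, interior]
  split_ifs with h
  · have h1 : (j : ℝ) ≠ 0 := by exact_mod_cast h.1.ne'
    have h2 : (N : ℝ) - j ≠ 0 := sub_ne_zero.2 (by exact_mod_cast h.2.ne')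
    have h3 : (N : ℝ) ≠ 0 := by exact_mod_cast (by omega : N ≠ 0)
    rw [recip, corecip]
    field_simp
    ring
  · simp

theorem interior_mul' (N : ℕ) (hN : 1 ≤ N) :
    weight (interior N (corecip N)) * weight (interior N recip) =
      (1 / N : ℝ) • (weight (interior N recip) + weight (interior N (corecip N))) := by
  rw [add_comm, ← interior_mul N hN]
  ext g j
  simp only [Module.End.mul_apply, weight_apply]
  ring

/-- The common value of the two alternating sums. -/
noncomputable def contracted (N : ℕ) : List ℕ → SeqOp :=
  alternating (contractible (1 / N : ℝ) partialSum (weight (interior N (corecip N))))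
    (contractible (1 / N : ℝ) partialSum (weight (interior N recip)))

/-! #### The sum over odd-even pairs -/

/-- The discretized iterated integral of level `N - 1`, translated by one. -/
noncomputable def shiftedNested (N : ℕ) : List ℕ → SeqOp :=
  chain (weakPair partialSum (weight (interior N (corecip N))) (weight (interior N recip)))
    fun b => partialSum * block partialSum (weight (interior N (corecip N))) b

theorem block_zero {A : Type*} [Ring A] (σ w : A) : block σ w 0 = block σ w 1 := by
  simp [block]

theorem block_rec {P : ℕ → Prop} (h0 : P 1 → P 0) (h1 : P 1)
    (h : ∀ c, P (c + 1) → P (c + 2)) : ∀ c, P c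
  | 0 => h0 h1
  | 1 => h1
  | c + 2 => h c (block_rec h0 h1 h (c + 1))

theorem partialSum_congr {n : ℕ} {g h : ℕ → ℝ} (hgh : ∀ m < n, g m = h m) :
    ∀ m ≤ n, partialSum g m = partialSum h m := fun _ hm =>
  Finset.sum_congr rfl fun j hj => hgh j ((Finset.mem_range.1 hj).trans_le hm)

theorem partialSum_add_one_congr {n : ℕ} {g h : ℕ → ℝ} (hgh : ∀ m < n, g m = h m) :
    ∀ m < n, (partialSum + 1) g m = (partialSum + 1) h m := fun m hm => by
  simp only [partialSum_add_one_apply]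
  exact Finset.sum_congr rfl fun j hj => hgh j (by rw [Finset.mem_range] at hj; omega)

/-- Rests on `n - p = (n + 1) - (p + 1)`. -/
theorem shifted_corecip_block {n : ℕ} (b : ℕ) {g h : ℕ → ℝ} (hgh : ∀ m ≤ n, g (m + 1) = h m) :
    block partialSum (weight (interior (n + 1) (corecip (n + 1)))) b g 0 = 0 ∧
    ∀ m ≤ n, block partialSum (weight (interior (n + 1) (corecip (n + 1)))) b g (m + 1) =
      block partialSum (weight (corecip n)) b h m := by
  have hw : ∀ m ≤ n, interior (n + 1) (corecip (n + 1)) (m + 1) = corecip n m := by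
    intro m hm
    rw [interior]
    split_ifs with h
    · simp [corecip]
    -- Both weights vanish here, the one on the right because `1 / 0 = 0`.
    · obtain rfl : m = n := by omega
      simp [corecip]
  induction b using block_rec with
  | h0 h => simpa only [block_zero] using h
  | h1 =>
    simp only [block_one, weight_apply]
    refine ⟨by simp [interior], fun m hm => ?_⟩
    rw [hw m hm, hgh m hm]
  | h c ih =>
    simp only [block_apply_succ, weight_apply]
    refine ⟨by simp [interior], fun m hm => ?_⟩
    rw [hw m hm, partialSum_add_one_apply, partialSum_add_one_apply, Finset.sum_range_succ', ih.1,
      add_zero]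
    congr 1
    exact Finset.sum_congr rfl fun j hj => ih.2 j (by rw [Finset.mem_range] at hj; omega)

theorem recip_block {n : ℕ} (a : ℕ) {g h : ℕ → ℝ} (hgh : ∀ m < n, g m = h m) :
    ∀ m < n, block partialSum (weight (interior n recip)) a g m =
      block partialSum (weight recip) a h m := by
  have hw : ∀ m < n, interior n recip m = recip m := by
    intro m hm
    rw [interior]
    split_ifs with h
    · rfl
    · obtain rfl : m = 0 := by omega
      simp [recip]
  induction a using block_rec with
  | h0 h => simpa only [block_zero] using h
  | h1 =>
    simp only [block_one, weight_apply]
    intro m hm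
    rw [hw m hm, hgh m hm]
  | h c ih =>
    simp only [block_apply_succ, weight_apply]
    intro m hm
    rw [hw m hm, partialSum_add_one_congr ih m hm]

theorem recip_block_congr {n : ℕ} (a : ℕ) {g h : ℕ → ℝ} (hgh : ∀ m < n, g m = h m) :
    ∀ m < n, block partialSum (weight recip) a g m = block partialSum (weight recip) a h m :=
  fun m hm => (recip_block a (fun _ _ => rfl) m hm).symm.trans (recip_block a hgh m hm)

/-- Only the variables with weight `1/(n-p)` are translated: `p < q` becomes `p + 1 ≤ q`, and `q ≤
p` becomes `q < p + 1`. This moves the weak links from (2,3), (4,5), … to (1,2), (3,4), …. -/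
theorem shiftedNested_succ {n : ℕ} : ∀ (c : List ℕ) {g h : ℕ → ℝ},
    (∀ m ≤ n, g (m + 1) = h m) → ∀ m ≤ n, shiftedNested (n + 1) c g (m + 1) = nested n c h m
  | [], _, _, hgh => hgh
  | [b], g, h, hgh => fun m hm => by
    obtain ⟨h0, h1⟩ := shifted_corecip_block b hgh
    simp only [shiftedNested, nested, chain, Module.End.mul_apply, partialSum_apply]
    rw [Finset.sum_range_succ', h0, add_zero]
    exact Finset.sum_congr rfl fun j hj => h1 j (by rw [Finset.mem_range] at hj; omega)
  | b :: a :: l, g, h, hgh => by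
    refine shiftedNested_succ l fun m hm => ?_
    obtain ⟨h0, h1⟩ := shifted_corecip_block b hgh
    simp only [weakPair, Module.End.mul_apply]
    rw [partialSum_apply, partialSum_add_one_apply]
    refine Finset.sum_congr rfl fun j hj => recip_block a (fun i hi => ?_) j
      (Nat.lt_succ_of_le (by rw [Finset.mem_range] at hj; omega))
    rw [partialSum_add_one_apply, partialSum_apply, Finset.sum_range_succ', h0, add_zero]
    exact Finset.sum_congr rfl fun j hj => h1 j (by rw [Finset.mem_range] at hj; omega)

theorem altOE_discreteIntegral (n : ℕ) {c : List ℕ} (hc : Even c.length) (hpos : ∀ i ∈ c, 1 ≤ i) :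
    altOE (1 / (n + 1 : ℕ) : ℝ) (discreteIntegral n) c = contracted (n + 1) c 1 (n + 1) := by
  have h1 : discreteIntegral n = fun c =>
      (evalAt (n + 1) ∘ₗ LinearMap.applyₗ (1 : ℕ → ℝ)) (shiftedNested (n + 1) c) := by
    ext c
    exact (shiftedNested_succ c (g := 1) (h := 1) (fun _ _ => rfl) n le_rfl).symm
  rw [h1, altOE_map, shiftedNested, altOE_chain]
  rw [chain_congr
    (fun a b ha hb => pairAlt_weakPair (interior_mul (n + 1) (by omega)) ha hb) c hpos]
  rw [chain_eq_alternating c hc]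
  rfl

/-! #### The sum over even-odd pairs -/

/-- The weight `1/(n-p)` does not vanish at `p = 0`; cutting it there is harmless only since `h 0 =
0`, which holds after any run of weights `1/q`. -/
theorem corecip_block {n : ℕ} (b : ℕ) {g h : ℕ → ℝ} (hgh : ∀ m < n, g m = h m) (h0 : h 0 = 0) :
    block partialSum (weight (corecip n)) b h 0 = 0 ∧
    ∀ m < n, block partialSum (weight (interior n (corecip n))) b g m =
      block partialSum (weight (corecip n)) b h m := by
  have hw : ∀ m < n, ∀ u v : ℝ, (m = 0 → v = 0) → u = v → interior n (corecip n) m * u =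
      corecip n m * v := by
    intro m hm u v h1 huv
    rw [interior]
    split_ifs with h
    · rw [huv]
    · rw [h1 (by omega)]
      simp
  induction b using block_rec with
  | h0 h => simpa only [block_zero] using h
  | h1 =>
    simp only [block_one, weight_apply]
    refine ⟨by simp [h0], fun m hm => ?_⟩
    exact hw m hm _ _ (fun h => h ▸ h0) (hgh m hm)
  | h c ih =>
    simp only [block_apply_succ, weight_apply]
    have h2 : (partialSum + 1) (block partialSum (weight (corecip n)) (c + 1) h) 0 = 0 := by
      simp [partialSum_add_one_apply, ih.1]
    refine ⟨by rw [h2, mul_zero], fun m hm => ?_⟩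
    exact hw m hm _ _ (fun h => h ▸ h2) (partialSum_add_one_congr ih.2 m hm)

theorem recip_block_zero (a : ℕ) (g : ℕ → ℝ) : block partialSum (weight recip) a g 0 = 0 := by
  induction a using block_rec with
  | h0 h => simpa only [block_zero] using h
  | h1 => simp [block_one, weight_apply, recip]
  | h c _ => simp [block_apply_succ, weight_apply, recip]

/-- The last block of the discretized iterated integral. -/
noncomputable def lastBlock (a : ℕ) : SeqOp := (partialSum + 1) * block partialSum (weight recip) a

/-- The first block of the discretized iterated integral. -/
noncomputable def firstBlock (N b : ℕ) : SeqOp :=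
  partialSum * block partialSum (weight (corecip N)) b

/-- All intermediate variables are automatically interior. `lastBlock` keeps its full weight because
its variables may reach `n`. -/
theorem chain_interior {n : ℕ} : ∀ (c : List ℕ) {g h : ℕ → ℝ}, (∀ m ≤ n, g m = h m) → ∀ m ≤ n,
    chain (weakPair partialSum (weight (interior n recip)) (weight (interior n (corecip n))))
      lastBlock c g m =
    chain (fun a b => firstBlock n b * lastBlock a) lastBlock c h m
  | [], _, _, hgh => hgh
  | [a], g, h, hgh => fun m hm => by
    simp only [chain, lastBlock, Module.End.mul_apply, partialSum_add_one_apply]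
    exact Finset.sum_congr rfl fun j hj => recip_block_congr (n := n + 1) a
      (fun m hm => hgh m (by omega)) j (by rw [Finset.mem_range] at hj; omega)
  | a :: b :: l, g, h, hgh => by
    refine chain_interior l fun m hm => partialSum_congr (n := n) (fun m hm => ?_) m hm
    refine (corecip_block b (fun m hm => ?_) ?_).2 m hm
    · simp only [lastBlock, Module.End.mul_apply]
      exact partialSum_add_one_congr (recip_block a fun m hm => hgh m hm.le) m hm
    · simp [lastBlock, partialSum_add_one_apply, recip_block_zero]

theorem discreteIntegral_cons (n b : ℕ) (l : List ℕ) :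
    discreteIntegral n (b :: l) =
      chain (weakPair partialSum (weight (interior n recip)) (weight (interior n (corecip n))))
        lastBlock l (firstBlock n b 1) n := by
  rw [chain_interior l (fun _ _ => rfl) n le_rfl, discreteIntegral, nested]
  exact congrArg (fun u : SeqOp => u 1 n) (chain_mul_eq (p := firstBlock n) (q := lastBlock) b l)

/-- Separates the terms whose smallest variable is 0: it has weight `1 / n` and imposes no condition
on the next variable. -/
theorem corecip_block_one {n : ℕ} (b : ℕ) : ∀ m < n,
    block partialSum (weight (corecip n)) (b + 2) 1 m =
      (1 / n : ℝ) * block partialSum (weight (corecip n)) (b + 1) 1 m +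
        block partialSum (weight (interior n (corecip n))) (b + 2) 1 m := by
  have h0 : ∀ b, block partialSum (weight (interior n (corecip n))) b 1 0 = 0 := by
    intro b
    induction b using block_rec with
    | h0 h => simpa only [block_zero] using h
    | h1 => simp [block_one, weight_apply, interior]
    | h c _ => simp [block_apply_succ, weight_apply, interior]
  have hstep : ∀ b m, m < n →
      corecip n m * (partialSum + 1)
          (block partialSum (weight (interior n (corecip n))) (b + 1) 1) m =
        block partialSum (weight (interior n (corecip n))) (b + 2) 1 m := by
    intro b m hm
    rw [block_apply_succ, weight_apply]
    rcases Nat.eq_zero_or_pos m with rfl | hm0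
    · simp [partialSum_add_one_apply, h0]
    · rw [interior, if_pos ⟨hm0, hm⟩]
  induction b with
  | zero =>
    intro m hm
    have h1 : block partialSum (weight (corecip n)) 2 1 m = corecip n m *
        (partialSum + 1) (block partialSum (weight (corecip n)) 1 1) m := by
      rw [block_apply_succ, weight_apply]
    rw [h1, ← hstep 0 m hm, partialSum_add_one_apply, partialSum_add_one_apply,
      Finset.sum_range_succ', Finset.sum_range_succ' _ m, h0, add_zero, mul_add, add_comm]
    congr 1
    · simp [block_one, weight_apply, corecip, mul_comm]
    · congr 1
      refine Finset.sum_congr rfl fun j hj => ?_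
      rw [Finset.mem_range] at hj
      simp [block_one, weight_apply, interior, show j + 1 < n by omega]
  | succ b ih =>
    intro m hm
    have h1 (c : ℕ) : block partialSum (weight (corecip n)) (c + 2) 1 m = corecip n m *
        (partialSum + 1) (block partialSum (weight (corecip n)) (c + 1) 1) m := by
      rw [block_apply_succ, weight_apply]
    rw [h1 (b + 1), h1 b, ← hstep (b + 1) m hm]
    simp only [partialSum_add_one_apply]
    rw [mul_left_comm, ← mul_add]
    congr 1
    rw [Finset.mul_sum, ← Finset.sum_add_distrib]
    exact Finset.sum_congr rfl fun j hj => ih j (by rw [Finset.mem_range] at hj; omega)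

/-- Lowering the first entry cancels the terms whose smallest variable is 0. In a run of length one
nothing is subtracted, and the term at 0 is the contraction `1 / n`. For `m = 0` that term is not in
the sum, so `1 ≤ m` is needed. -/
theorem singleAlt_firstBlock {n : ℕ} {b : ℕ} (hb : 1 ≤ b) : ∀ m ≤ n, 1 ≤ m →
    singleAlt (1 / n : ℝ) (fun b => firstBlock n b 1) b m =
      contractible (1 / n : ℝ) partialSum (weight (interior n (corecip n))) b 1 m := by
  intro m hm hm1
  rcases Nat.exists_eq_add_of_le' hb with ⟨b, rfl⟩
  rcases b with _ | b
  · obtain ⟨m, rfl⟩ := Nat.exists_eq_add_of_le' hm1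
    simp only [singleAlt, contractible, firstBlock, zero_add, lt_irrefl, if_false, sub_zero,
      if_true, block_one, Module.End.mul_apply, LinearMap.add_apply, Pi.add_apply,
      partialSum_apply, LinearMap.smul_apply, Pi.smul_apply, Module.End.one_apply]
    rw [Finset.sum_range_succ', Finset.sum_range_succ' _ m]
    have : ∀ j ∈ Finset.range m, weight (corecip n) 1 (j + 1) =
        weight (interior n (corecip n)) 1 (j + 1) := by
      intro j hj
      rw [Finset.mem_range] at hj
      simp [weight_apply, interior, show j + 1 < n by omega]
    rw [Finset.sum_congr rfl this]
    simp [weight_apply, corecip, interior]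
  · simp only [singleAlt, contractible, firstBlock, Module.End.mul_apply, LinearMap.add_apply]
    rw [if_pos (by omega), if_neg (by omega)]
    simp only [Pi.sub_apply, Pi.smul_apply, partialSum_apply, smul_eq_mul, Finset.mul_sum,
      ← Finset.sum_sub_distrib, LinearMap.zero_apply, add_zero]
    refine Finset.sum_congr rfl fun j hj => ?_
    have := corecip_block_one (n := n) b j (by rw [Finset.mem_range] at hj; omega)
    rw [show b + 1 + 1 = b + 2 from rfl, this]
    simp

/-- The mirror effect at the other end: the terms whose largest variable is `n` carry the factor `1
/ n`, and they cancel or become the contraction. -/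
theorem singleAlt_lastBlock {n : ℕ} {a : ℕ} (ha : 1 ≤ a) (g : ℕ → ℝ) :
    singleAlt (1 / n : ℝ) lastBlock a g n =
      contractible (1 / n : ℝ) partialSum (weight (interior n recip)) a g n := by
  have h : ∀ a, partialSum (block partialSum (weight (interior n recip)) a g) n =
      partialSum (block partialSum (weight recip) a g) n := fun a =>
    partialSum_congr (recip_block a fun _ _ => rfl) n le_rfl
  rcases Nat.exists_eq_add_of_le' ha with ⟨a, rfl⟩
  rcases a with _ | a
  · simp only [singleAlt, contractible, lastBlock, zero_add, lt_irrefl, if_false, sub_zero,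
      if_true, Module.End.mul_apply, LinearMap.add_apply, Pi.add_apply, h]
    simp [block_one, weight_apply, recip]
  · simp only [singleAlt, contractible, lastBlock, Module.End.mul_apply, LinearMap.add_apply,
      Pi.add_apply, h]
    rw [if_pos (by omega), if_neg (by omega)]
    simp [block_apply_succ, weight_apply, recip]

/-- Agreement from 1 on suffices because interior weights vanish at 0; this matches the range in
which `singleAlt_firstBlock` holds. -/
theorem contractible_congr {n : ℕ} {t : ℝ} (w : ℕ → ℝ) (c : ℕ) {g h : ℕ → ℝ}
    (hgh : ∀ m ≤ n, 1 ≤ m → g m = h m) : ∀ m ≤ n, 1 ≤ m →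
    contractible t partialSum (weight (interior n w)) c g m =
      contractible t partialSum (weight (interior n w)) c h m := by
  have key : ∀ m < n, block partialSum (weight (interior n w)) c g m =
      block partialSum (weight (interior n w)) c h m := by
    induction c using block_rec with
    | h0 h => simpa only [block_zero] using h
    | h1 =>
      intro m hm
      simp only [block_one, weight_apply, interior]
      split_ifs with h
      · rw [hgh m hm.le h.1]
      · simp
    | h c ih =>
      intro m hm
      rw [block_apply_succ, block_apply_succ, weight_apply, weight_apply,
        partialSum_add_one_congr ih m hm]
  intro m hm hm1
  simp only [contractible, LinearMap.add_apply, Pi.add_apply, Module.End.mul_apply]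
  rw [partialSum_congr key m hm]
  split_ifs
  · simp [hgh m hm hm1]
  · rfl

theorem alternating_contractible_congr {n : ℕ} {t : ℝ} : ∀ (c : List ℕ) (v w : ℕ → ℝ)
    {g h : ℕ → ℝ}, (∀ m ≤ n, 1 ≤ m → g m = h m) → ∀ m ≤ n, 1 ≤ m →
    alternating (contractible t partialSum (weight (interior n v)))
      (contractible t partialSum (weight (interior n w))) c g m =
    alternating (contractible t partialSum (weight (interior n v)))
      (contractible t partialSum (weight (interior n w))) c h m
  | [], _, _, _, _, hgh => hgh
  | a :: l, v, w, _, _, hgh => fun m hm hm1 =>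
    alternating_contractible_congr l w v (contractible_congr v a hgh) m hm hm1

theorem chain_singleAlt_lastBlock {n : ℕ} : ∀ (c : List ℕ), (∀ i ∈ c, 1 ≤ i) →
    ∀ (q : ℕ → SeqOp) (g : ℕ → ℝ), Odd c.length →
    chain (fun a b => q b *
        contractible (1 / n : ℝ) partialSum (weight (interior n recip)) a)
      (singleAlt (1 / n : ℝ) lastBlock) c g n =
    alternating (contractible (1 / n : ℝ) partialSum (weight (interior n recip))) q c g n
  | [], _, _, _, h => by simp at h
  | [a], hc, _, g, _ => singleAlt_lastBlock (hc a (by simp)) g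
  | a :: b :: l, hc, q, g, h =>
    chain_singleAlt_lastBlock l (fun i hi => hc i (by simp [hi])) q _
      (by simpa [Nat.odd_add] using h)

theorem altEO_discreteIntegral {n : ℕ} (hn : 1 ≤ n) {c : List ℕ} (hc : Even c.length)
    (hpos : ∀ i ∈ c, 1 ≤ i) :
    altEO (1 / n : ℝ) (discreteIntegral n) c = contracted n c 1 n := by
  rcases c with _ | ⟨b, l⟩
  · simp [altEO_eq, ones, big, reduce, discreteIntegral, nested, contracted, chain, alternating,
      EvenOdd]
  · have hl : Odd l.length := by simpa [Nat.even_add_one] using hc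
    have h1 (b : ℕ) : (fun l => discreteIntegral n (b :: l)) = fun l =>
        (evalAt n ∘ₗ LinearMap.applyₗ (firstBlock n b 1)) (chain (weakPair partialSum
          (weight (interior n recip)) (weight (interior n (corecip n)))) lastBlock l) := by
      ext l
      exact discreteIntegral_cons n b l
    have hpos' : ∀ i ∈ l, 1 ≤ i := fun i hi => hpos i (by simp [hi])
    rw [altEO_cons _ _ _ hl]
    simp only [h1, altOE_map, altOE_chain]
    rw [chain_congr (fun a b ha hb => pairAlt_weakPair (interior_mul' n hn) ha hb) l hpos']
    simp only [LinearMap.comp_apply, LinearMap.applyₗ_apply_apply, evalAt, LinearMap.proj_apply]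
    rw [chain_singleAlt_lastBlock l hpos' _ _ hl, chain_singleAlt_lastBlock l hpos' _ _ hl]
    rw [contracted, alternating, Module.End.mul_apply]
    rw [← alternating_contractible_congr l _ _ (singleAlt_firstBlock (hpos b (by simp))) n le_rfl
      hn]
    rw [singleAlt]
    split_ifs
    · simp
    · simp

theorem altEO_discreteIntegral_eq (n : ℕ) {c : List ℕ} (hc : Even c.length)
    (hpos : ∀ i ∈ c, 1 ≤ i) :
    altEO (1 / (n + 1 : ℕ) : ℝ) (discreteIntegral (n + 1)) c =
      altOE (1 / (n + 1 : ℕ) : ℝ) (discreteIntegral n) c := by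
  rw [altEO_discreteIntegral (by omega) hc hpos, altOE_discreteIntegral n hc hpos]

theorem discreteIntegral_nil (n : ℕ) : discreteIntegral n [] = 1 := rfl

theorem nested_zero : ∀ (c : List ℕ) (g : ℕ → ℝ), c ≠ [] → nested 0 c g 0 = 0
  | [], _, h => absurd rfl h
  | [b], g, _ => by simp [nested, chain, partialSum_apply]
  | [b, a], g, _ => by
    simp [nested, chain, partialSum_apply, recip_block_zero]
  | b :: a :: c :: l, g, _ => nested_zero (c :: l) _ (by simp)

/-! ### The recurrence for the polynomials -/

/-- Adding 1 is a bijection from the members satisfying `P` to the remaining ones. -/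
theorem even_card_of_swap {A : Finset ℕ} {P : ℕ → Prop} [DecidablePred P]
    (hP : ∀ i, 1 ≤ i → (P i ↔ ¬ P (i + 1))) (h0 : 0 ∉ A)
    (h1 : ∀ i ∈ A, P i → i + 1 ∈ A) (h2 : ∀ i ∈ A, ¬ P i → i - 1 ∈ A) : Even A.card := by
  have h : (A.filter P).card = (A.filter fun i => ¬ P i).card := by
    refine Finset.card_nbij' (· + 1) (· - 1) ?_ ?_ ?_ ?_
    · intro i hi
      simp only [Finset.coe_filter, Set.mem_ofPred_eq] at hi ⊢
      exact ⟨h1 i hi.1 hi.2, (hP i (Nat.one_le_iff_ne_zero.2 fun h => h0 (h ▸ hi.1))).1 hi.2⟩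
    · intro i hi
      simp only [Finset.coe_filter, Set.mem_ofPred_eq] at hi ⊢
      have h3 := h2 i hi.1 hi.2
      have h4 : i - 1 ≠ 0 := fun h => h0 (h ▸ h3)
      refine ⟨h3, (hP _ (by omega)).2 ?_⟩
      rw [show i - 1 + 1 = i by omega]
      exact hi.2
    · intro i _
      simp
    · intro i hi
      simp only [Finset.coe_filter, Set.mem_ofPred_eq] at hi
      have : i ≠ 0 := fun h => h0 (h ▸ hi.1)
      simp only
      omega
  rw [← Finset.card_filter_add_card_filter_not (s := A) P, h]
  exact ⟨_, rfl⟩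

theorem mem_pairsEO {c : List ℕ} {m : ℕ} {p : Finset ℕ × Finset ℕ} :
    p ∈ pairsEO c m ↔ (p.1 ⊆ ones c ∧ p.2 ⊆ big c) ∧ EvenOdd p.1 ∧ m ≤ p.1.card + p.2.card ∧
      ∀ r ∈ Finset.Icc 1 (c.length / 2 - 1), ¬ {2 * r, 2 * r + 1} ⊆ p.2 := by
  simp only [pairsEO, Finset.mem_filter, Finset.mem_product, Finset.mem_powerset]

theorem mem_pairsOE {c : List ℕ} {m : ℕ} {p : Finset ℕ × Finset ℕ} :
    p ∈ pairsOE c m ↔ (p.1 ⊆ ones c ∧ p.2 ⊆ big c) ∧ OddEven p.1 ∧ m ≤ p.1.card + p.2.card ∧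
      ∀ r ∈ Finset.Icc 1 (c.length / 2), ¬ {2 * r - 1, 2 * r} ⊆ p.2 := by
  simp only [pairsOE, Finset.mem_filter, Finset.mem_product, Finset.mem_powerset]

theorem EvenOdd.even_card {A : Finset ℕ} (h : EvenOdd A) (h0 : 0 ∉ A) : Even A.card :=
  even_card_of_swap (P := Even) (fun i _ => by rw [Nat.even_add_one, not_not]) h0
    (fun i hi => (h i hi).1) fun i hi hP => (h i hi).2 (Nat.not_even_iff_odd.1 hP)

theorem OddEven.even_card {A : Finset ℕ} (h : OddEven A) (h0 : 0 ∉ A) : Even A.card :=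
  even_card_of_swap (P := Odd) (fun i _ => by rw [Nat.odd_add_one, not_not]) h0
    (fun i hi => (h i hi).1) fun i hi hP => (h i hi).2 (Nat.not_odd_iff_even.1 hP)

/-! ### Length, weight and positivity of reduced lists. -/

section Reduce

variable {c : List ℕ} {A B : Finset ℕ}

theorem range'_filter_toFinset (n : ℕ) (A : Finset ℕ) :
    ((List.range' 1 n).filter (· ∉ A)).toFinset = Finset.Icc 1 n \ A := by
  ext i
  simp only [List.mem_toFinset, List.mem_filter, List.mem_range'_1, decide_eq_true_eq,
    Finset.mem_sdiff, Finset.mem_Icc]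
  constructor <;> rintro ⟨h, h'⟩ <;> exact ⟨by omega, h'⟩

theorem ones_subset (c : List ℕ) : ones c ⊆ Finset.Icc 1 c.length := Finset.filter_subset _ _

theorem big_subset (c : List ℕ) : big c ⊆ Finset.Icc 1 c.length := Finset.filter_subset _ _

theorem reduce_length (hA : A ⊆ ones c) : (reduce c A B).length + A.card = c.length := by
  rw [reduce, List.length_map,
    ← List.toFinset_card_of_nodup (List.Nodup.filter _ List.nodup_range'),
    range'_filter_toFinset,
    Finset.card_sdiff_add_card_eq_card (hA.trans (ones_subset c))]
  simp

theorem reduce_sum (hA : A ⊆ ones c) (hB : B ⊆ big c) :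
    (reduce c A B).sum + A.card + B.card = c.sum := by
  have hdisj : B ⊆ Finset.Icc 1 c.length \ A := by
    intro i hi
    refine Finset.mem_sdiff.2 ⟨big_subset c (hB hi), fun h => ?_⟩
    have h1 := hA h
    have h2 := hB hi
    simp only [ones, big, Finset.mem_filter] at h1 h2
    omega
  have e1 : c.sum = ∑ i ∈ Finset.Icc 1 c.length, entry c i := by
    conv_lhs => rw [← map_entry c]
    rw [← List.sum_toFinset _ List.nodup_range']
    have := range'_filter_toFinset c.length ∅
    simp only [Finset.notMem_empty, not_false_eq_true, decide_true, List.filter_true,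
      Finset.sdiff_empty] at this
    rw [this]
  have e2 : A.card = ∑ i ∈ A, entry c i := by
    rw [Finset.card_eq_sum_ones]
    refine Finset.sum_congr rfl fun i hi => ?_
    have := hA hi
    simp only [ones, Finset.mem_filter] at this
    exact this.2.symm
  have e3 : B.card = ∑ i ∈ Finset.Icc 1 c.length \ A, if i ∈ B then 1 else 0 := by
    rw [Finset.sum_ite_mem, Finset.inter_eq_right.2 hdisj, Finset.card_eq_sum_ones]
  rw [reduce, ← List.sum_toFinset _ (List.Nodup.filter _ List.nodup_range'),
    range'_filter_toFinset, e1,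
    ← Finset.sum_sdiff (hA.trans (ones_subset c)), e2, e3, add_right_comm,
    ← Finset.sum_add_distrib]
  congr 1
  refine Finset.sum_congr rfl fun i _ => ?_
  split_ifs with h
  · have := hB h
    simp only [big, Finset.mem_filter] at this
    omega
  · omega

theorem reduce_pos (hc : ∀ i ∈ c, 1 ≤ i) (hB : B ⊆ big c) : ∀ i ∈ reduce c A B, 1 ≤ i := by
  intro i hi
  simp only [reduce, List.mem_map, List.mem_filter, List.mem_range'_1] at hi
  obtain ⟨j, ⟨hj, -⟩, rfl⟩ := hi
  split_ifs with h
  · have := hB h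
    simp only [big, Finset.mem_filter] at this
    omega
  · have : entry c j ∈ c := by
      rw [entry, List.getD_eq_getElem _ _ (by omega)]
      exact List.getElem_mem _
    exact hc _ this

theorem reduce_empty (c : List ℕ) : reduce c ∅ ∅ = c := by
  conv_rhs => rw [← map_entry c]
  simp [reduce]

end Reduce

/-- The lists `c` to which the polynomials `frakD c` are attached in the theorem. -/
def IsExponents (c : List ℕ) : Prop := Even c.length ∧ ∀ i ∈ c, 1 ≤ i

theorem zero_notMem_of_subset_ones {c : List ℕ} {A : Finset ℕ} (h : A ⊆ ones c) : 0 ∉ A :=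
  zero_notMem_of_mem_ones (Finset.mem_powerset.2 h)

theorem IsExponents.reduceEO {c : List ℕ} (hc : IsExponents c) {m : ℕ} {p : Finset ℕ × Finset ℕ}
    (hp : p ∈ pairsEO c m) : IsExponents (reduce c p.1 p.2) := by
  rw [mem_pairsEO] at hp
  have h := hp.2.1.even_card (zero_notMem_of_subset_ones hp.1.1)
  have h1 := hc.1
  rw [← reduce_length (B := p.2) hp.1.1, Nat.even_add] at h1
  exact ⟨h1.2 h, reduce_pos hc.2 hp.1.2⟩

theorem IsExponents.reduceOE {c : List ℕ} (hc : IsExponents c) {m : ℕ} {p : Finset ℕ × Finset ℕ}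
    (hp : p ∈ pairsOE c m) : IsExponents (reduce c p.1 p.2) := by
  rw [mem_pairsOE] at hp
  have h := hp.2.1.even_card (zero_notMem_of_subset_ones hp.1.1)
  have h1 := hc.1
  rw [← reduce_length (B := p.2) hp.1.1, Nat.even_add] at h1
  exact ⟨h1.2 h, reduce_pos hc.2 hp.1.2⟩

/-- Position 1 always survives. This keeps `X ^ m` from ever multiplying the empty word. -/
theorem reduceEO_ne_nil {c : List ℕ} (hc : c ≠ []) {m : ℕ} {p : Finset ℕ × Finset ℕ}
    (hp : p ∈ pairsEO c m) : reduce c p.1 p.2 ≠ [] := by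
  rw [mem_pairsEO] at hp
  intro h
  have h1 : 1 ∉ p.1 := fun h1 => zero_notMem_of_subset_ones hp.1.1 ((hp.2.1 1 h1).2 (by decide))
  have h2 := reduce_length (B := p.2) hp.1.1
  rw [h, List.length_nil, zero_add] at h2
  have h3 := Finset.eq_of_subset_of_card_le (hp.1.1.trans (ones_subset c)) (by simp [h2])
  rw [h3] at h1
  exact h1 (Finset.mem_Icc.2 ⟨le_rfl, List.length_pos_of_ne_nil hc⟩)

/-- As `A` has even cardinality, it is empty here, and a `B` with at most one element contains no
linked pair of either kind. -/
theorem pairsEO_filter_lt (c : List ℕ) :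
    (pairsEO c 0).filter (fun p => p.1.card + p.2.card < 2) =
      (pairsOE c 0).filter fun p => p.1.card + p.2.card < 2 := by
  have hpair : ∀ (B : Finset ℕ) (i j : ℕ), i ≠ j → B.card < 2 → ¬ {i, j} ⊆ B := by
    intro B i j hij hB h
    have := Finset.card_le_card h
    rw [Finset.card_pair hij] at this
    omega
  ext p
  rw [Finset.mem_filter, Finset.mem_filter, mem_pairsEO, mem_pairsOE]
  constructor
  · rintro ⟨⟨h1, h2, -, -⟩, h4⟩
    have h5 := h2.even_card (zero_notMem_of_subset_ones h1.1)
    have h6 : p.1 = ∅ := Finset.card_eq_zero.1 (by rw [Nat.even_iff] at h5; omega)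
    refine ⟨⟨h1, by simp [h6, OddEven], by simp, fun r hr => ?_⟩, h4⟩
    rw [Finset.mem_Icc] at hr
    exact hpair _ _ _ (by omega) (by omega)
  · rintro ⟨⟨h1, h2, -, -⟩, h4⟩
    have h5 := h2.even_card (zero_notMem_of_subset_ones h1.1)
    have h6 : p.1 = ∅ := Finset.card_eq_zero.1 (by rw [Nat.even_iff] at h5; omega)
    exact ⟨⟨h1, by simp [h6, EvenOdd], by simp, fun r hr => hpair _ _ _ (by omega) (by omega)⟩, h4⟩

theorem pairsEO_filter_le (c : List ℕ) (m : ℕ) :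
    (pairsEO c 0).filter (fun p => m ≤ p.1.card + p.2.card) = pairsEO c m := by
  ext p
  simp only [Finset.mem_filter, mem_pairsEO, zero_le, true_and]
  tauto

theorem pairsOE_filter_le (c : List ℕ) (m : ℕ) :
    (pairsOE c 0).filter (fun p => m ≤ p.1.card + p.2.card) = pairsOE c m := by
  ext p
  simp only [Finset.mem_filter, mem_pairsOE, zero_le, true_and]
  tauto

/-- The difference of the two alternating sums only involves pairs with at least two positions. -/
theorem sum_pairsEO_sub_sum_pairsOE {M : Type*} [AddCommGroup M] (c : List ℕ)
    (f : Finset ℕ × Finset ℕ → M) :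
    ∑ p ∈ pairsEO c 0, f p - ∑ p ∈ pairsOE c 0, f p =
      ∑ p ∈ pairsEO c 2, f p - ∑ p ∈ pairsOE c 2, f p := by
  rw [← Finset.sum_filter_add_sum_filter_not (pairsEO c 0) fun p => p.1.card + p.2.card < 2,
    ← Finset.sum_filter_add_sum_filter_not (pairsOE c 0) fun p => p.1.card + p.2.card < 2,
    pairsEO_filter_lt]
  simp only [not_lt, pairsEO_filter_le, pairsOE_filter_le]
  abel

theorem sum_pairsEO_zero {M : Type*} [AddCommGroup M] (c : List ℕ)
    (f : Finset ℕ × Finset ℕ → M) :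
    ∑ p ∈ pairsEO c 0, f p = f (∅, ∅) + ∑ p ∈ pairsEO c 1, f p := by
  rw [← Finset.sum_filter_not_add_sum_filter (pairsEO c 0) fun p => 1 ≤ p.1.card + p.2.card,
    pairsEO_filter_le]
  congr 1
  rw [← Finset.sum_singleton f (∅, ∅)]
  refine Finset.sum_congr ?_ fun _ _ => rfl
  ext ⟨A, B⟩
  rw [Finset.mem_filter, mem_pairsEO, Finset.mem_singleton, Prod.mk.injEq]
  constructor
  · rintro ⟨-, h⟩
    exact ⟨Finset.card_eq_zero.1 (by simp only at h; omega),
      Finset.card_eq_zero.1 (by simp only at h; omega)⟩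
  · rintro ⟨rfl, rfl⟩
    simp [EvenOdd]

theorem frakD_eq {c : List ℕ} (hc : c ≠ []) : frakD c =
    (∑ p ∈ pairsEO c 1, (-1) ^ (p.2.card + 1) *
      (frakD (reduce c p.1 p.2) * X ^ (p.1.card + p.2.card))) +
    (∑ p ∈ pairsEO c 2, (-1) ^ (p.2.card + 1) *
      (frakD (reduce c p.1 p.2) * (Y * X ^ (p.1.card + p.2.card - 1)))) +
    ∑ p ∈ pairsOE c 2, (-1) ^ p.2.card *
      (frakD (reduce c p.1 p.2) * (Y * X ^ (p.1.card + p.2.card - 1))) := by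
  obtain ⟨a, t, rfl⟩ := List.exists_cons_of_ne_nil hc
  rw [frakD]
  simp only [Finset.sum_attach (pairsEO (a :: t) 1) (fun p => (-1) ^ (p.2.card + 1) *
      (frakD (reduce (a :: t) p.1 p.2) * X ^ (p.1.card + p.2.card))),
    Finset.sum_attach (pairsEO (a :: t) 2) (fun p => (-1) ^ (p.2.card + 1) *
      (frakD (reduce (a :: t) p.1 p.2) * (Y * X ^ (p.1.card + p.2.card - 1)))),
    Finset.sum_attach (pairsOE (a :: t) 2) (fun p => (-1) ^ p.2.card *
      (frakD (reduce (a :: t) p.1 p.2) * (Y * X ^ (p.1.card + p.2.card - 1))))]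

/-! ### The sequences attached to a polynomial -/

/-- The action of polynomials on sequences: `x` divides by `n`, and `y` sums and divides. -/
noncomputable def polyOp : Poly →+* SeqOpᵐᵒᵖ :=
  FreeRing.lift fun
    | Letter.x => MulOpposite.op (weight recip)
    | Letter.y => MulOpposite.op (weight recip * partialSum)

/-- The sequence whose `n`th entry is the part with largest summation index `n` of the multiple
zeta values attached to a polynomial. -/
noncomputable def polySeq (p : Poly) : ℕ → ℝ := (polyOp p).unop (Pi.single 0 1)

theorem polyOp_X : polyOp X = MulOpposite.op (weight recip) := by
  simp [polyOp, X]

theorem polyOp_Y : polyOp Y = MulOpposite.op (weight recip * partialSum) := by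
  simp [polyOp, Y]

theorem weight_pow_apply (w g : ℕ → ℝ) (m n : ℕ) : (weight w ^ m) g n = w n ^ m * g n := by
  induction m with
  | zero => simp
  | succ m ih =>
    rw [pow_succ', Module.End.mul_apply, weight_apply, ih]
    ring

/-- Words are read from the smallest summation index upwards, so the right factor acts last; hence
the opposite ring. -/
theorem polySeq_mul (p q : Poly) : polySeq (p * q) = (polyOp q).unop (polySeq p) := by
  simp [polySeq]

theorem polyOp_X_pow_apply (g : ℕ → ℝ) (m n : ℕ) :
    (polyOp (X ^ m)).unop g n = recip n ^ m * g n := by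
  rw [map_pow, polyOp_X, MulOpposite.unop_pow, MulOpposite.unop_op, weight_pow_apply]

theorem polyOp_Y_mul_X_pow_apply (g : ℕ → ℝ) {m : ℕ} (hm : 1 ≤ m) (n : ℕ) :
    (polyOp (Y * X ^ (m - 1))).unop g n = recip n ^ m * partialSum g n := by
  rw [map_mul, MulOpposite.unop_mul, Module.End.mul_apply, polyOp_X_pow_apply, polyOp_Y,
    MulOpposite.unop_op, Module.End.mul_apply, weight_apply, ← mul_assoc, ← pow_succ,
    Nat.sub_add_cancel hm]

theorem polySeq_mul_X_pow (p : Poly) (m n : ℕ) :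
    polySeq (p * X ^ m) n = recip n ^ m * polySeq p n := by
  rw [polySeq_mul, polyOp_X_pow_apply]

theorem polySeq_mul_Y_mul_X_pow (p : Poly) {m : ℕ} (hm : 1 ≤ m) (n : ℕ) :
    polySeq (p * (Y * X ^ (m - 1))) n = recip n ^ m * partialSum (polySeq p) n := by
  rw [polySeq_mul, polyOp_Y_mul_X_pow_apply _ hm]

theorem polySeq_neg_one_pow_mul (p : Poly) (m n : ℕ) :
    polySeq ((-1) ^ m * p) n = (-1) ^ m * polySeq p n := by
  rcases Nat.even_or_odd m with h | h <;> simp [h.neg_one_pow, polySeq]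

theorem polySeq_add (p q : Poly) (n : ℕ) : polySeq (p + q) n = polySeq p n + polySeq q n := by
  simp [polySeq]

theorem polySeq_sum {ι : Type*} (s : Finset ι) (f : ι → Poly) (n : ℕ) :
    polySeq (∑ i ∈ s, f i) n = ∑ i ∈ s, polySeq (f i) n := by
  simp [polySeq, map_sum, Finset.unop_sum, LinearMap.sum_apply]

theorem polySeq_frakD {c : List ℕ} (hc : c ≠ []) (n : ℕ) : polySeq (frakD c) n =
    (∑ p ∈ pairsEO c 1, (-1) ^ (p.2.card + 1) *
      (recip n ^ (p.1.card + p.2.card) * polySeq (frakD (reduce c p.1 p.2)) n)) +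
    (∑ p ∈ pairsEO c 2, (-1) ^ (p.2.card + 1) *
      (recip n ^ (p.1.card + p.2.card) * partialSum (polySeq (frakD (reduce c p.1 p.2))) n)) +
    ∑ p ∈ pairsOE c 2, (-1) ^ p.2.card *
      (recip n ^ (p.1.card + p.2.card) * partialSum (polySeq (frakD (reduce c p.1 p.2))) n) := by
  rw [frakD_eq hc]
  simp only [polySeq_add, polySeq_sum, polySeq_neg_one_pow_mul, polySeq_mul_X_pow]
  congr 1
  · congr 1
    refine Finset.sum_congr rfl fun p hp => ?_
    rw [mem_pairsEO] at hp
    rw [polySeq_mul_Y_mul_X_pow _ (by omega)]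
  · refine Finset.sum_congr rfl fun p hp => ?_
    rw [mem_pairsOE] at hp
    rw [polySeq_mul_Y_mul_X_pow _ (by omega)]

/-- The truncated value of `frakD c`. -/
noncomputable def truncated (n : ℕ) (c : List ℕ) : ℝ := (partialSum + 1) (polySeq (frakD c)) n

theorem partialSum_succ_polySeq (n : ℕ) (c : List ℕ) :
    partialSum (polySeq (frakD c)) (n + 1) = truncated n c := by
  rw [truncated, partialSum_add_one_apply, partialSum_apply]

/-- Move the `X ^ m` terms of the recursion to the left: the even-odd sum of the new summands at
index `n + 1` equals the odd-even minus the even-odd sum of `truncated n`, over pairs with at least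
two positions. Smaller pairs are common to both families and cancel, so that restriction can be
dropped; then `truncated (n + 1)` is the new summand plus `truncated n`. -/
theorem altEO_truncated (n : ℕ) {c : List ℕ} (hc : c ≠ []) :
    altEO (1 / (n + 1 : ℕ) : ℝ) (truncated (n + 1)) c =
      altOE (1 / (n + 1 : ℕ) : ℝ) (truncated n) c := by
  have h1 : ∀ c, truncated (n + 1) c = polySeq (frakD c) (n + 1) + truncated n c := by
    intro c
    rw [truncated, LinearMap.add_apply, Pi.add_apply, partialSum_succ_polySeq, add_comm]
    rfl
  have h2 := polySeq_frakD hc (n + 1)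
  simp only [partialSum_succ_polySeq, pow_succ, mul_neg, mul_one, neg_mul,
    Finset.sum_neg_distrib] at h2
  have h3 := sum_pairsEO_sub_sum_pairsOE c fun p =>
    (-1) ^ p.2.card * (recip (n + 1) ^ (p.1.card + p.2.card) * truncated n (reduce c p.1 p.2))
  have h4 := sum_pairsEO_zero c fun p => (-1) ^ p.2.card *
    (recip (n + 1) ^ (p.1.card + p.2.card) * polySeq (frakD (reduce c p.1 p.2)) (n + 1))
  simp only [Finset.card_empty, pow_zero, one_mul, add_zero, reduce_empty] at h4
  simp only [altEO, altOE, smul_eq_mul, h1, mul_add, Finset.sum_add_distrib, mul_assoc]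
  rw [show (1 / (n + 1 : ℕ) : ℝ) = recip (n + 1) from rfl]
  linarith

theorem truncated_nil (n : ℕ) : truncated n [] = 1 := by
  rw [truncated, partialSum_add_one_apply, frakD]
  simp [polySeq, Pi.single_apply]

theorem truncated_zero {c : List ℕ} (hc : c ≠ []) : truncated 0 c = 0 := by
  have : ∀ c, partialSum (polySeq (frakD c)) 0 = 0 := fun c => by simp [partialSum_apply]
  rw [truncated, LinearMap.add_apply, Pi.add_apply, this, zero_add, Module.End.one_apply,
    polySeq_frakD hc]
  simp only [this, mul_zero, Finset.sum_const_zero, add_zero]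
  refine Finset.sum_eq_zero fun p hp => ?_
  rw [mem_pairsEO] at hp
  rw [recip, Nat.cast_zero, div_zero, zero_pow (by omega)]
  simp

/-- Both sides satisfy the same recurrence. In its even-odd side, the pair of empty sets gives the
value at `c` itself, and every other pair a list of smaller sum; this allows an inner induction on
the sum, within the induction on `n`. -/
theorem truncated_eq_discreteIntegral (n : ℕ) :
    ∀ c : List ℕ, IsExponents c → truncated n c = discreteIntegral n c := by
  induction n with
  | zero =>
    intro c _
    rcases eq_or_ne c [] with rfl | h
    · rw [truncated_nil, discreteIntegral_nil]
    · rw [truncated_zero h, discreteIntegral, nested_zero c _ h]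
  | succ n ih =>
    suffices ∀ s, ∀ c : List ℕ, c.sum = s → IsExponents c →
        truncated (n + 1) c = discreteIntegral (n + 1) c from fun c => this _ c rfl
    intro s
    induction s using Nat.strong_induction_on with
    | _ s ihs =>
      rintro c rfl hc
      rcases eq_or_ne c [] with rfl | h
      · rw [truncated_nil, discreteIntegral_nil]
      · have h1 := altEO_truncated n h
        have h2 := altEO_discreteIntegral_eq n hc.1 hc.2
        have h3 : altOE (1 / (n + 1 : ℕ) : ℝ) (truncated n) c =
            altOE (1 / (n + 1 : ℕ) : ℝ) (discreteIntegral n) c :=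
          Finset.sum_congr rfl fun p hp => by rw [ih _ (hc.reduceOE hp)]
        rw [h3, ← h2, altEO, altEO, sum_pairsEO_zero, sum_pairsEO_zero] at h1
        have h4 : ∀ p ∈ pairsEO c 1, truncated (n + 1) (reduce c p.1 p.2) =
            discreteIntegral (n + 1) (reduce c p.1 p.2) := fun p hp =>
          ihs _ (pairsEO_lt le_rfl hp) _ rfl (hc.reduceEO hp)
        rw [Finset.sum_congr rfl fun p hp => by rw [h4 p hp]] at h1
        simpa [reduce_empty] using h1

/-! ### The words occurring in the polynomials -/

/-- A word as a polynomial. -/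
def monomial (w : FreeMonoid Letter) : Poly := FreeAbelianGroup.of w

/-- The words `e_l` of weight `k`, where all components of `l` are at least `2`. -/
def wordsGeTwo (k : ℕ) : Set Poly :=
  {p | ∃ l : List ℕ, l.sum = k ∧ (∀ i ∈ l, 2 ≤ i) ∧ p = monomial (word l)}

theorem word_append (l l' : List ℕ) : word (l ++ l') = word l * word l' := by
  simp [word, FreeMonoid.ofList_append]

theorem monomial_mul (v w : FreeMonoid Letter) :
    monomial v * monomial w = monomial (v * w) :=
  FreeAbelianGroup.of_mul_of v w

theorem X_pow_eq (m : ℕ) :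
    X ^ m = monomial (FreeMonoid.ofList (List.replicate m Letter.x)) := by
  induction m with
  | zero => rfl
  | succ m ih =>
    rw [pow_succ', ih, X]
    exact monomial_mul _ _

theorem Y_mul_X_pow_eq (m : ℕ) : Y * X ^ (m - 1) = monomial (word [m]) := by
  rw [X_pow_eq, Y]
  refine (monomial_mul _ _).trans ?_
  simp only [word, List.flatMap_cons, List.flatMap_nil, List.append_nil]
  rfl

theorem word_mul_X_pow (l : List ℕ) {a : ℕ} (ha : 1 ≤ a) (m : ℕ) :
    monomial (word (l ++ [a])) * X ^ m = monomial (word (l ++ [a + m])) := by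
  rw [word_append, word_append, ← monomial_mul, ← monomial_mul, ← Y_mul_X_pow_eq, ← Y_mul_X_pow_eq,
    mul_assoc, mul_assoc, ← pow_add, Nat.sub_add_comm ha]

theorem mul_mem_closure_of {S T : Set Poly} {q : Poly}
    (h : ∀ p ∈ S, p * q ∈ AddSubgroup.closure T) {p : Poly} (hp : p ∈ AddSubgroup.closure S) :
    p * q ∈ AddSubgroup.closure T := by
  induction hp using AddSubgroup.closure_induction with
  | mem x hx => exact h x hx
  | zero => simp
  | add x y _ _ hx hy => rw [add_mul]; exact add_mem hx hy
  | neg x _ hx => rw [neg_mul]; exact neg_mem hx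

theorem neg_one_pow_mul_mem {S : AddSubgroup Poly} {p : Poly} (hp : p ∈ S) (n : ℕ) :
    (-1) ^ n * p ∈ S := by
  rcases Nat.even_or_odd n with h | h <;> simpa [h.neg_one_pow] using hp

/-- Positive weight excludes the empty word; otherwise `X ^ m` just enlarges the last component. -/
theorem mul_X_pow_mem {p : Poly} {k : ℕ} (hk : 0 < k)
    (hp : p ∈ AddSubgroup.closure (wordsGeTwo k)) (m : ℕ) :
    p * X ^ m ∈ AddSubgroup.closure (wordsGeTwo (k + m)) := by
  refine mul_mem_closure_of ?_ hp
  rintro _ ⟨l, rfl, hl, rfl⟩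
  obtain ⟨l, a, rfl⟩ := (List.eq_nil_or_concat' l).resolve_left (by rintro rfl; simp at hk)
  have ha : 2 ≤ a := hl a (by simp)
  refine AddSubgroup.subset_closure ⟨l ++ [a + m], by simp [add_assoc], ?_,
    word_mul_X_pow l ((by norm_num : 1 ≤ 2).trans ha) m⟩
  intro i hi
  rcases List.mem_append.1 hi with h | h
  · exact hl i (by simp [h])
  · rw [List.mem_singleton.1 h]
    omega

theorem mul_Y_mul_X_pow_mem {p : Poly} {k : ℕ} (hp : p ∈ AddSubgroup.closure (wordsGeTwo k))
    {m : ℕ} (hm : 2 ≤ m) :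
    p * (Y * X ^ (m - 1)) ∈ AddSubgroup.closure (wordsGeTwo (k + m)) := by
  refine mul_mem_closure_of ?_ hp
  rintro _ ⟨l, rfl, hl, rfl⟩
  refine AddSubgroup.subset_closure ⟨l ++ [m], by simp, ?_, ?_⟩
  · intro i hi
    rcases List.mem_append.1 hi with h | h
    · exact hl i h
    · rwa [List.mem_singleton.1 h]
  · rw [Y_mul_X_pow_eq, word_append, monomial_mul]

theorem IsExponents.sum_pos {c : List ℕ} (hc : IsExponents c) (h : c ≠ []) : 0 < c.sum := by
  obtain ⟨a, l, rfl⟩ := List.exists_cons_of_ne_nil h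
  have := hc.2 a (by simp)
  rw [List.sum_cons]
  omega

theorem frakD_mem_closure : ∀ (s : ℕ) (c : List ℕ), c.sum = s → IsExponents c →
    frakD c ∈ AddSubgroup.closure (wordsGeTwo c.sum) := by
  intro s
  induction s using Nat.strong_induction_on with
  | _ s ih =>
    rintro c rfl hc
    rcases eq_or_ne c [] with rfl | hne
    · rw [frakD]
      exact AddSubgroup.subset_closure ⟨[], rfl, by simp, rfl⟩
    · rw [frakD_eq hne]
      refine add_mem (add_mem ?_ ?_) ?_
      · refine sum_mem fun p hp => neg_one_pow_mul_mem ?_ _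
        have h1 := ih _ (pairsEO_lt le_rfl hp) _ rfl (hc.reduceEO hp)
        have h2 := mul_X_pow_mem ((hc.reduceEO hp).sum_pos (reduceEO_ne_nil hne hp)) h1
          (p.1.card + p.2.card)
        rw [mem_pairsEO] at hp
        rwa [← add_assoc, reduce_sum hp.1.1 hp.1.2] at h2
      · refine sum_mem fun p hp => neg_one_pow_mul_mem ?_ _
        have h1 := ih _ (pairsEO_lt (by norm_num) hp) _ rfl (hc.reduceEO hp)
        rw [mem_pairsEO] at hp
        have h2 := mul_Y_mul_X_pow_mem h1 hp.2.2.1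
        rwa [← add_assoc, reduce_sum hp.1.1 hp.1.2] at h2
      · refine sum_mem fun p hp => neg_one_pow_mul_mem ?_ _
        have h1 := ih _ (pairsOE_lt (by norm_num) hp) _ rfl (hc.reduceOE hp)
        rw [mem_pairsOE] at hp
        have h2 := mul_Y_mul_X_pow_mem h1 hp.2.2.1
        rwa [← add_assoc, reduce_sum hp.1.1 hp.1.2] at h2

theorem replicate_append_inj {R R' : List Letter} (hR : R.head? ≠ some Letter.x)
    (hR' : R'.head? ≠ some Letter.x) : ∀ {m m' : ℕ},
    List.replicate m Letter.x ++ R = List.replicate m' Letter.x ++ R' → m = m' ∧ R = R'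
  | 0, 0, h => ⟨rfl, by simpa using h⟩
  | 0, m' + 1, h => by
    simp only [List.replicate_zero, List.nil_append, List.replicate_succ, List.cons_append] at h
    simp [h] at hR
  | m + 1, 0, h => by
    simp only [List.replicate_zero, List.nil_append, List.replicate_succ, List.cons_append] at h
    simp [← h] at hR'
  | m + 1, m' + 1, h => by
    simp only [List.replicate_succ, List.cons_append, List.cons.injEq, true_and] at h
    obtain ⟨h1, h2⟩ := replicate_append_inj hR hR' h
    exact ⟨by rw [h1], h2⟩

theorem toList_word_cons (a : ℕ) (l : List ℕ) :
    (word (a :: l)).toList = Letter.y :: (List.replicate (a - 1) Letter.x ++ (word l).toList) := by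
  simp [word]

theorem head?_word (l : List ℕ) : (word l).toList.head? ≠ some Letter.x := by
  rcases l with _ | ⟨a, l⟩
  · simp [word]
  · simp [toList_word_cons]

/-- Positivity matters because truncated subtraction gives the components 0 and 1 the same word. -/
theorem word_injective : ∀ {l l' : List ℕ}, (∀ i ∈ l, 0 < i) → (∀ i ∈ l', 0 < i) →
    (word l).toList = (word l').toList → l = l'
  | [], [], _, _, _ => rfl
  | [], a :: l, _, _, h => by simp [toList_word_cons] at h; simp [word] at h
  | a :: l, [], _, _, h => by simp [toList_word_cons] at h; simp [word] at h
  | a :: l, a' :: l', hl, hl', h => by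
    rw [toList_word_cons, toList_word_cons, List.cons.injEq] at h
    obtain ⟨h1, h2⟩ := replicate_append_inj (head?_word l) (head?_word l') h.2
    have h3 := hl a (by simp)
    have h4 := hl' a' (by simp)
    rw [show a = a' by omega, word_injective (fun i hi => hl i (by simp [hi]))
      (fun i hi => hl' i (by simp [hi])) h2]

theorem coeff_monomial (w v : FreeMonoid Letter) :
    coeff w (monomial v) = if v.toList = w.toList then 1 else 0 := by
  exact FreeAbelianGroup.lift_apply_of _ _

theorem mem_geTwo {k : ℕ} (hk : 0 < k) {κ : Composition k} :
    κ ∈ geTwo k ↔ ∀ i ∈ κ.blocks, 2 ≤ i := by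
  simp only [geTwo, admissible, Finset.mem_filter, Finset.mem_univ, true_and, and_iff_right_iff_imp]
  intro h
  have hne : κ.blocks ≠ [] := by
    intro h0
    have := κ.blocks_sum
    rw [h0, List.sum_nil] at this
    omega
  rw [List.getLastD_eq_getLast?, List.getLast?_eq_some_getLast hne]
  exact h _ (List.getLast_mem hne)

theorem eq_sum_coeff {k : ℕ} (hk : 0 < k) {p : Poly}
    (hp : p ∈ AddSubgroup.closure (wordsGeTwo k)) :
    p = ∑ l ∈ geTwo k, coeff (word l.blocks) p • monomial (word l.blocks) := by
  induction hp using AddSubgroup.closure_induction with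
  | mem x hx =>
    obtain ⟨l, hl, hl2, rfl⟩ := hx
    let κ : Composition k := ⟨l, fun {i} hi => (by norm_num : 0 < 2).trans_le (hl2 i hi), hl⟩
    rw [Finset.sum_eq_single κ]
    · rw [coeff_monomial, if_pos rfl, one_smul]
    · intro κ' _ hne
      rw [coeff_monomial, if_neg, zero_smul]
      intro h
      exact hne (Composition.ext (word_injective (fun i hi => κ.blocks_pos hi)
        (fun i hi => κ'.blocks_pos hi) h).symm)
    · intro h
      exact absurd ((mem_geTwo hk).2 hl2) h
  | zero => simp
  | add x y _ _ hx hy =>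
    simp only [map_add, add_smul, Finset.sum_add_distrib]
    rw [← hx, ← hy]
  | neg x _ hx =>
    simp only [map_neg, neg_smul, Finset.sum_neg_distrib]
    rw [← hx]

open Filter Topology

/-! ### Truncated multiple zeta values -/

/-- The sum of `1 / (n₁ ^ l₁ ⋯ n_r ^ l_r)` over `m < n₁ < ⋯ < n_r ≤ n`. -/
noncomputable def truncatedZeta : List ℕ → ℕ → ℕ → ℝ
  | [], _, _ => 1
  | a :: l, m, n => ∑ j ∈ Finset.Ioc m n, recip j ^ a * truncatedZeta l j n

/-- For a general initial sequence `g`, as the induction requires; `g m` weights the sums with lower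
bound `m`. -/
theorem sum_polyOp_word (n : ℕ) : ∀ (l : List ℕ), (∀ i ∈ l, 0 < i) → ∀ g : ℕ → ℝ,
    (partialSum + 1) ((polyOp (monomial (word l))).unop g) n =
      ∑ m ∈ Finset.range (n + 1), g m * truncatedZeta l m n
  | [], _, g => by
    have : monomial (word []) = 1 := rfl
    rw [this, map_one, MulOpposite.unop_one, Module.End.one_apply, partialSum_add_one_apply]
    simp [truncatedZeta]
  | a :: l, hl, g => by
    have h1 : monomial (word (a :: l)) =
        Y * X ^ (a - 1) * monomial (word l) := by
      rw [Y_mul_X_pow_eq, monomial_mul, ← word_append]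
      rfl
    rw [h1, map_mul, MulOpposite.unop_mul, Module.End.mul_apply,
      sum_polyOp_word n l (fun i hi => hl i (by simp [hi]))]
    simp only [polyOp_Y_mul_X_pow_apply g (hl a (by simp)), partialSum_apply, truncatedZeta,
      Finset.mul_sum, Finset.sum_mul]
    rw [Finset.sum_comm' (t' := Finset.range (n + 1)) (s' := fun i => Finset.Ioc i n)]
    · exact Finset.sum_congr rfl fun _ _ => Finset.sum_congr rfl fun _ _ => by ring
    · intro i j
      simp only [Finset.mem_range, Finset.mem_Ioc]
      omega

theorem sum_polySeq_word {l : List ℕ} (hl : ∀ i ∈ l, 0 < i) (n : ℕ) :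
    (partialSum + 1) (polySeq (monomial (word l))) n = truncatedZeta l 0 n := by
  rw [polySeq, sum_polyOp_word n l hl]
  simp [Pi.single_apply]

/-! ### Bounds for truncated sums and convergence of the series. -/

theorem recip_nonneg (j : ℕ) : 0 ≤ recip j := by
  rw [recip]
  positivity

theorem truncatedZeta_nonneg : ∀ (l : List ℕ) (m n : ℕ), 0 ≤ truncatedZeta l m n
  | [], _, _ => zero_le_one
  | a :: l, _, n => Finset.sum_nonneg fun j _ =>
    mul_nonneg (pow_nonneg (recip_nonneg j) a) (truncatedZeta_nonneg l j n)

theorem recip_le_one (j : ℕ) : recip j ≤ 1 := by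
  rcases Nat.eq_zero_or_pos j with rfl | h
  · simp [recip]
  · rw [recip, div_le_one (by positivity)]
    exact_mod_cast h

theorem sum_Ioc_telescope (m n : ℕ) :
    ∑ j ∈ Finset.Ioc m n, (2 / ((j : ℝ) * (j + 1))) ≤ 2 / (m + 1) := by
  rcases le_or_gt n m with h | h
  · rw [Finset.Ioc_eq_empty (by omega), Finset.sum_empty]
    positivity
  · have : ∀ n, m ≤ n → ∑ j ∈ Finset.Ioc m n, (2 / ((j : ℝ) * (j + 1))) =
        2 / ((m : ℝ) + 1) - 2 / (n + 1) := by
      intro n hn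
      induction n, hn using Nat.le_induction with
      | base => simp
      | succ n hn ih =>
        rw [Finset.sum_Ioc_succ_top hn, ih]
        push_cast
        field_simp
        ring
    rw [this n h.le]
    have : (0 : ℝ) ≤ 2 / (n + 1) := by positivity
    linarith

/-- The bound reproduces itself: `2 / (j + 1)` times `1 / j` telescopes over `j > m` to at most `2 /
(m + 1)`. The last component starts it through `1 / j² ≤ 2 / (j (j + 1))`. -/
theorem truncatedZeta_le : ∀ (l : List ℕ), (∀ i ∈ l, 0 < i) → 2 ≤ l.getLastD 0 → ∀ m n : ℕ,
    truncatedZeta l m n ≤ 2 / (m + 1)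
  | [], _, h, _, _ => by simp at h
  | [a], _, h, m, n => by
    refine le_trans (Finset.sum_le_sum fun j hj => ?_) (sum_Ioc_telescope m n)
    have hj : 1 ≤ j := by rw [Finset.mem_Ioc] at hj; omega
    have hj' : (1 : ℝ) ≤ j := by exact_mod_cast hj
    rw [truncatedZeta, mul_one]
    refine (pow_le_pow_of_le_one (recip_nonneg j) (recip_le_one j) (by simpa using h)).trans ?_
    rw [recip, div_pow, one_pow, div_le_div_iff₀ (by positivity) (by positivity)]
    nlinarith
  | a :: b :: l, hl, h, m, n => by
    refine le_trans (Finset.sum_le_sum fun j hj => ?_) (sum_Ioc_telescope m n)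
    have hj : 1 ≤ j := by rw [Finset.mem_Ioc] at hj; omega
    have ih := truncatedZeta_le (b :: l) (fun i hi => hl i (by simp [hi])) (by simpa using h) j n
    have h1 : recip j ^ a ≤ recip j := by
      simpa using pow_le_pow_of_le_one (recip_nonneg j) (recip_le_one j) (hl a (by simp))
    refine (mul_le_mul h1 ih (truncatedZeta_nonneg _ _ _) (recip_nonneg j)).trans_eq ?_
    rw [recip, div_mul_div_comm, one_mul]

/-- The strictly increasing sequences of length `r` between `m` and `n`. -/
noncomputable def increasing (r m n : ℕ) : Finset (Fin r → ℕ) :=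
  open Classical in (Fintype.piFinset fun _ : Fin r => Finset.Ioc m n).filter StrictMono

theorem mem_increasing {r m n : ℕ} {f : Fin r → ℕ} :
    f ∈ increasing r m n ↔ (∀ i, m < f i ∧ f i ≤ n) ∧ StrictMono f := by
  simp [increasing]

theorem sum_increasing : ∀ (l : List ℕ) (m n : ℕ),
    ∑ f ∈ increasing l.length m n, ∏ i : Fin l.length, 1 / (f i : ℝ) ^ l.get i =
      truncatedZeta l m n
  | [], m, n => by
    have : increasing 0 m n = {Fin.elim0} := by
      ext f
      simp only [mem_increasing, Finset.mem_singleton]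
      exact iff_of_true ⟨fun i => i.elim0, fun i => i.elim0⟩ (Subsingleton.elim _ _)
    simp only [List.length_nil, this, Finset.sum_singleton, truncatedZeta]
    simp
  | a :: l, m, n => by
    simp only [truncatedZeta, ← sum_increasing l, Finset.mul_sum]
    rw [Finset.sum_sigma']
    refine Finset.sum_bij' (fun f _ => ⟨f 0, Fin.tail f⟩)
      (fun p _ => (Fin.cons p.1 p.2 : Fin (l.length + 1) → ℕ)) ?_ ?_ ?_ ?_ ?_
    · intro f hf
      obtain ⟨h1, h2⟩ := mem_increasing.1 hf
      rw [Finset.mem_sigma, Finset.mem_Ioc, mem_increasing]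
      refine ⟨h1 0, fun i => ⟨h2 (Fin.succ_pos i), (h1 i.succ).2⟩, fun i j hij => h2 ?_⟩
      exact Fin.succ_lt_succ_iff.2 hij
    · rintro ⟨j, f⟩ hf
      rw [Finset.mem_sigma, Finset.mem_Ioc, mem_increasing] at hf
      obtain ⟨h0, h1, h2⟩ := hf
      rw [mem_increasing]
      refine ⟨fun i => ?_, fun i i' => ?_⟩
      · refine Fin.cases h0 (fun i => ?_) i
        simp only [Fin.cons_succ]
        exact ⟨h0.1.trans (h1 i).1, (h1 i).2⟩
      · refine Fin.cases ?_ (fun i => ?_) i <;> refine Fin.cases ?_ (fun i' => ?_) i'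
        · intro h
          exact absurd h (lt_irrefl _)
        · intro _
          simpa using (h1 i').1
        · intro h
          exact absurd h (Fin.not_lt_zero _)
        · intro h
          simpa using h2 (Fin.succ_lt_succ_iff.1 h)
    · intro f _
      exact Fin.cons_self_tail f
    · rintro ⟨j, f⟩ _
      simp
    · intro f _
      exact (Fin.prod_univ_succ _).trans (by simp [recip, Fin.tail])

theorem term_nonneg (l : List ℕ) (f : Range l.length) : 0 ≤ term l f :=
  Finset.prod_nonneg fun _ _ => by positivity

/-- The part of the range of summation with all entries at most `n`. -/
noncomputable def boundedRange (r n : ℕ) : Finset (Range r) :=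
  open Classical in (increasing r 0 n).subtype _

theorem mem_boundedRange {r n : ℕ} {f : Range r} : f ∈ boundedRange r n ↔ ∀ i, f.1 i ≤ n := by
  rw [boundedRange, Finset.mem_subtype, mem_increasing]
  exact ⟨fun h i => (h.1 i).2, fun h => ⟨fun i => ⟨f.2.1 i, h i⟩, f.2.2⟩⟩

theorem sum_boundedRange (l : List ℕ) (n : ℕ) :
    ∑ f ∈ boundedRange l.length n, term l f = truncatedZeta l 0 n := by
  rw [← sum_increasing, boundedRange]
  exact Finset.sum_subtype_of_mem
    (fun f : Fin l.length → ℕ => ∏ i : Fin l.length, 1 / (f i : ℝ) ^ l.get i) fun f hf =>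
    ⟨fun i => ((mem_increasing.1 hf).1 i).1, (mem_increasing.1 hf).2⟩

theorem boundedRange_mono (r : ℕ) : Monotone (boundedRange r) := fun _ _ h _ hf =>
  mem_boundedRange.2 fun i => (mem_boundedRange.1 hf i).trans h

theorem exists_mem_boundedRange {r : ℕ} (f : Range r) : ∃ n, f ∈ boundedRange r n :=
  ⟨∑ i, f.1 i, mem_boundedRange.2 fun i => Finset.single_le_sum (fun _ _ => Nat.zero_le _)
    (Finset.mem_univ i)⟩

theorem tendsto_boundedRange (r : ℕ) : Tendsto (boundedRange r) atTop atTop :=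
  tendsto_atTop_finset_of_monotone (boundedRange_mono r) exists_mem_boundedRange

theorem summable_term {l : List ℕ} (hl : ∀ i ∈ l, 0 < i) (h : 2 ≤ l.getLastD 0) :
    Summable (term l) := by
  refine summable_of_sum_le (c := 2) (term_nonneg l) fun u => ?_
  obtain ⟨n, hn⟩ := ((tendsto_boundedRange l.length).eventually_ge_atTop u).exists
  refine (Finset.sum_le_sum_of_subset_of_nonneg hn fun _ _ _ => term_nonneg l _).trans ?_
  rw [sum_boundedRange]
  simpa using truncatedZeta_le l hl h 0 n

theorem tendsto_truncatedZeta {l : List ℕ} (hl : ∀ i ∈ l, 0 < i) (h : 2 ≤ l.getLastD 0) :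
    Tendsto (truncatedZeta l 0) atTop (𝓝 (zeta l)) := by
  have := (summable_term hl h).hasSum.comp (tendsto_boundedRange l.length)
  exact this.congr fun n => sum_boundedRange l n

/-! ### The discretized iterated integral of a truncated multiple zeta value -/

/-- The iterated integral with strict inequalities inside the blocks of letters `y`. -/
noncomputable def strictNested (N : ℕ) : List ℕ → SeqOp :=
  chain (fun b a => ((partialSum + 1) * weight recip) ^ a *
    (partialSum * weight (corecip N)) ^ b) fun b => (partialSum * weight (corecip N)) ^ b

/-- The word of which an iterated integral is formed. -/
def blockPoly : List ℕ → Poly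
  | [] => 1
  | [b] => Y ^ b
  | b :: a :: l => Y ^ b * X ^ a * blockPoly l

/-- The factor `Y ^ a` stands for the ones already read; the condition on the last entry ensures
that none are left over at the end. -/
theorem blockPoly_exponentsAux : ∀ (t : List ℕ) (a : ℕ), (∀ i ∈ t, 0 < i) →
    (t = [] → a = 0) → (t ≠ [] → 2 ≤ t.getLastD 0) →
    blockPoly (exponentsAux a t) = Y ^ a * monomial (word t)
  | [], a, _, ha, _ => by
    rw [ha rfl]
    rfl
  | m :: t, a, ht, _, h => by
    have h1 : monomial (word (m :: t)) = Y * X ^ (m - 1) * monomial (word t) := by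
      rw [Y_mul_X_pow_eq, monomial_mul, ← word_append]
      rfl
    have hlast : t ≠ [] → 2 ≤ t.getLastD 0 := by
      intro hne
      obtain ⟨b, l, rfl⟩ := List.exists_cons_of_ne_nil hne
      simpa using h (by simp)
    have ht' : ∀ i ∈ t, 0 < i := fun i hi => ht i (by simp [hi])
    rw [exponentsAux, h1]
    split_ifs with hm
    · have hne : t ≠ [] := by
        rintro rfl
        have := h (by simp)
        simp at this
        omega
      have : m = 1 := le_antisymm hm (ht m (by simp))
      rw [blockPoly_exponentsAux t (a + 1) ht' (fun h => absurd h hne) hlast, this]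
      simp [pow_succ, mul_assoc]
    · rw [blockPoly, blockPoly_exponentsAux t 0 ht' (fun _ => rfl) hlast]
      simp [pow_succ, mul_assoc]

theorem isExponents_exponentsAux : ∀ (t : List ℕ) (a : ℕ), IsExponents (exponentsAux a t)
  | [], _ => ⟨by simp [exponentsAux], by simp [exponentsAux]⟩
  | m :: t, a => by
    rw [exponentsAux]
    split_ifs with hm
    · exact isExponents_exponentsAux t _
    · obtain ⟨h1, h2⟩ := isExponents_exponentsAux t 0
      refine ⟨by simpa [Nat.even_add_one] using h1, ?_⟩
      intro i hi
      rcases List.mem_cons.1 hi with rfl | hi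
      · omega
      rcases List.mem_cons.1 hi with rfl | hi
      · omega
      · exact h2 i hi

theorem isExponents_exponents (k : List ℕ) : IsExponents (exponents k) :=
  isExponents_exponentsAux k 0

theorem sum_exponentsAux : ∀ (t : List ℕ) (a : ℕ), (∀ i ∈ t, 0 < i) →
    (t = [] → a = 0) → (t ≠ [] → 2 ≤ t.getLastD 0) → (exponentsAux a t).sum = a + t.sum
  | [], a, _, ha, _ => by simp [exponentsAux, ha rfl]
  | m :: t, a, ht, _, h => by
    have hlast : t ≠ [] → 2 ≤ t.getLastD 0 := by
      intro hne
      obtain ⟨b, l, rfl⟩ := List.exists_cons_of_ne_nil hne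
      simpa using h (by simp)
    have ht' : ∀ i ∈ t, 0 < i := fun i hi => ht i (by simp [hi])
    have hm0 := ht m (by simp)
    rw [exponentsAux]
    split_ifs with hm
    · have hne : t ≠ [] := by
        rintro rfl
        have := h (by simp)
        simp at this
        omega
      rw [sum_exponentsAux t (a + 1) ht' (fun h => absurd h hne) hlast, List.sum_cons]
      omega
    · rw [List.sum_cons, List.sum_cons, sum_exponentsAux t 0 ht' (fun _ => rfl) hlast,
        List.sum_cons]
      omega

/-! ### Connected sums: from the strict iterated sum to the truncated zeta value. -/

/-- The connector between the iterated integral and the iterated sum. -/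
noncomputable def connector (N n m : ℕ) : ℝ := (m.choose n : ℝ) / N.choose n

/-- The sequence `g` is the transform of `z` under the connector. -/
def Connected (N : ℕ) (g z : ℕ → ℝ) : Prop :=
  ∀ m ≤ N, g m = ∑ n ∈ Finset.range (N + 1), z n * connector N n m

/-- Exchanges a difference in `n` weighted by `1/(N-p)` for a difference in `p` weighted by
`1/(n+1)`; both then telescope in `partialSum_connector`. -/
theorem connector_sub {N n p : ℕ} (hn : n < N) (hp : p < N) :
    corecip N p * connector N n p - corecip N p * connector N (n + 1) p =
      recip (n + 1) * (connector N (n + 1) (p + 1) - connector N (n + 1) p) := by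
  have h1 : (N.choose (n + 1) : ℝ) * (n + 1) = N.choose n * (N - n) := by
    have := Nat.choose_succ_right_eq N n
    rw [← Nat.cast_sub hn.le]
    exact_mod_cast this
  have h2 : (p.choose (n + 1) : ℝ) * (n + 1) = p.choose n * (p - n) := by
    have := Nat.choose_succ_right_eq p n
    rcases le_or_gt n p with h | h
    · rw [← Nat.cast_sub h]
      exact_mod_cast this
    · simp [Nat.choose_eq_zero_of_lt h, Nat.choose_eq_zero_of_lt (h.trans (Nat.lt_succ_self n))]
  have hA : (N.choose n : ℝ) ≠ 0 := by exact_mod_cast (Nat.choose_pos hn.le).ne'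
  have hB : (N.choose (n + 1) : ℝ) ≠ 0 := by exact_mod_cast (Nat.choose_pos hn).ne'
  have hNp : (N : ℝ) - p ≠ 0 := sub_ne_zero.2 (by exact_mod_cast hp.ne')
  have hn1 : (n : ℝ) + 1 ≠ 0 := by positivity
  simp only [connector, corecip, recip, Nat.choose_succ_succ p n]
  push_cast
  rw [← sub_eq_zero]
  field_simp
  linear_combination (p.choose n : ℝ) * h1 - (N.choose n : ℝ) * h2

theorem connector_self {N n : ℕ} (hn : n ≤ N) : connector N n N = 1 :=
  div_self (by exact_mod_cast (Nat.choose_pos hn).ne')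

theorem partialSum_connector {N n : ℕ} (hn : n ≤ N) : ∀ m ≤ N,
    ∑ p ∈ Finset.range m, corecip N p * connector N n p =
      ∑ i ∈ Finset.Ico n N, recip (i + 1) * connector N (i + 1) m := by
  intro m hm
  induction m with
  | zero => simp [connector]
  | succ m ih =>
    rw [Finset.sum_range_succ, ih (by omega), eq_comm, ← sub_eq_iff_eq_add',
      ← Finset.sum_sub_distrib]
    have h : ∀ i ∈ Finset.Ico n N, recip (i + 1) * connector N (i + 1) (m + 1) -
        recip (i + 1) * connector N (i + 1) m =
        -(corecip N m * connector N (i + 1) m - corecip N m * connector N i m) := fun i hi => by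
      rw [Finset.mem_Ico] at hi
      have := connector_sub hi.2 (Nat.lt_of_succ_le hm)
      linarith
    rw [Finset.sum_congr rfl h, Finset.sum_neg_distrib,
      Finset.sum_Ico_sub (fun i => corecip N m * connector N i m) hn]
    have : connector N N m = 0 := by
      simp [connector, Nat.choose_eq_zero_of_lt (Nat.lt_of_succ_le hm)]
    rw [this]
    ring

/-- Since `C(q,n)/q = C(q-1,n-1)/n`, this is the hockey-stick identity. -/
theorem partialSum_recip_connector {N n : ℕ} (hn : 1 ≤ n) (m : ℕ) :
    ∑ q ∈ Finset.range (m + 1), recip q * connector N n q = recip n * connector N n m := by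
  induction m with
  | zero => simp [connector, recip, Nat.choose_eq_zero_of_lt (Nat.lt_of_succ_le hn)]
  | succ m ih =>
    rw [Finset.sum_range_succ, ih]
    obtain ⟨n, rfl⟩ := Nat.exists_eq_add_of_le' hn
    have h1 : ((m : ℝ) + 1) * m.choose n = (m + 1).choose (n + 1) * (n + 1) := by
      exact_mod_cast Nat.add_one_mul_choose_eq m n
    have hm1 : (m : ℝ) + 1 ≠ 0 := by positivity
    have hn1 : (n : ℝ) + 1 ≠ 0 := by positivity
    have h2 : ((m + 1).choose (n + 1) : ℝ) = m.choose n + m.choose (n + 1) := by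
      exact_mod_cast Nat.choose_succ_succ m n
    simp only [connector, recip]
    rw [div_mul_div_comm, div_mul_div_comm, div_mul_div_comm]
    push_cast
    rcases eq_or_ne (N.choose (n + 1) : ℝ) 0 with h | h
    · simp [h]
    · field_simp
      linear_combination -h1 - ((m : ℝ) + 1) * h2

theorem Connected.y {N : ℕ} {g z : ℕ → ℝ} (h : Connected N g z) :
    Connected N ((partialSum * weight (corecip N)) g) ((weight recip * partialSum) z) := by
  intro m hm
  simp only [Module.End.mul_apply, partialSum_apply, weight_apply]
  have h1 : ∀ p ∈ Finset.range m, corecip N p * g p =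
      ∑ n ∈ Finset.range (N + 1), z n * (corecip N p * connector N n p) := by
    intro p hp
    rw [h p (by rw [Finset.mem_range] at hp; omega), Finset.mul_sum]
    exact Finset.sum_congr rfl fun _ _ => by ring
  rw [Finset.sum_congr rfl h1, Finset.sum_comm]
  conv_rhs => rw [Finset.sum_range_succ']
  have h2 : recip 0 = 0 := by simp [recip]
  rw [h2, zero_mul, zero_mul, add_zero]
  have h3 : ∀ n ∈ Finset.range (N + 1),
      ∑ p ∈ Finset.range m, z n * (corecip N p * connector N n p) =
      ∑ i ∈ Finset.Ico n N, z n * (recip (i + 1) * connector N (i + 1) m) := by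
    intro n hn
    rw [← Finset.mul_sum, partialSum_connector (by rw [Finset.mem_range] at hn; omega) m hm,
      Finset.mul_sum]
  rw [Finset.sum_congr rfl h3]
  rw [Finset.sum_comm' (t' := Finset.range N) (s' := fun i => Finset.range (i + 1))]
  · refine Finset.sum_congr rfl fun i _ => ?_
    rw [← Finset.sum_mul]
    ring
  · intro n i
    simp only [Finset.mem_range, Finset.mem_Ico]
    omega

/-- The identity behind this fails for `n = 0`, hence `z 0 = 0`, which a preceding `y` provides. -/
theorem Connected.x {N : ℕ} {g z : ℕ → ℝ} (h : Connected N g z) (h0 : z 0 = 0) :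
    Connected N (((partialSum + 1) * weight recip) g) (weight recip z) := by
  intro m hm
  rw [Module.End.mul_apply, partialSum_add_one_apply]
  simp only [weight_apply]
  have h1 : ∀ p ∈ Finset.range (m + 1), recip p * g p =
      ∑ n ∈ Finset.range (N + 1), z n * (recip p * connector N n p) := by
    intro p hp
    rw [h p (by rw [Finset.mem_range] at hp; omega), Finset.mul_sum]
    exact Finset.sum_congr rfl fun _ _ => by ring
  rw [Finset.sum_congr rfl h1, Finset.sum_comm]
  refine Finset.sum_congr rfl fun n _ => ?_
  rw [← Finset.mul_sum]
  rcases Nat.eq_zero_or_pos n with rfl | hn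
  · simp [h0]
  · rw [partialSum_recip_connector hn]
    ring

theorem Connected.y_pow {N : ℕ} {g z : ℕ → ℝ} (h : Connected N g z) (b : ℕ) :
    Connected N (((partialSum * weight (corecip N)) ^ b) g) ((polyOp (Y ^ b)).unop z) := by
  rw [map_pow, MulOpposite.unop_pow, polyOp_Y, MulOpposite.unop_op]
  induction b with
  | zero => exact h
  | succ b ih =>
    rw [pow_succ', pow_succ']
    exact ih.y

theorem Connected.x_pow {N : ℕ} {g z : ℕ → ℝ} (h : Connected N g z) (h0 : z 0 = 0) (a : ℕ) :
    Connected N ((((partialSum + 1) * weight recip) ^ a) g) ((polyOp (X ^ a)).unop z) := by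
  induction a with
  | zero => simpa using h
  | succ a ih =>
    have h1 : (polyOp (X ^ (a + 1))).unop z = weight recip ((polyOp (X ^ a)).unop z) := by
      rw [pow_succ, map_mul, MulOpposite.unop_mul, polyOp_X, MulOpposite.unop_op]
      rfl
    rw [pow_succ', h1]
    exact ih.x (by rw [polyOp_X_pow_apply, h0, mul_zero])

theorem polyOp_Y_pow_zero {b : ℕ} (hb : 1 ≤ b) (z : ℕ → ℝ) : (polyOp (Y ^ b)).unop z 0 = 0 := by
  obtain ⟨b, rfl⟩ := Nat.exists_eq_add_of_le' hb
  rw [pow_succ, map_mul, MulOpposite.unop_mul, polyOp_Y, MulOpposite.unop_op, mul_assoc,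
    Module.End.mul_apply, weight_apply]
  simp [recip]

theorem Connected.strictNested {N : ℕ} : ∀ (c : List ℕ), (∀ i ∈ c, 1 ≤ i) → ∀ {g z : ℕ → ℝ},
    Connected N g z → Connected N (strictNested N c g) ((polyOp (blockPoly c)).unop z)
  | [], _, g, z, h => by
    rw [blockPoly, map_one]
    exact h
  | [b], _, _, _, h => h.y_pow b
  | b :: a :: l, hc, g, z, h => by
    rw [blockPoly, map_mul, map_mul, MulOpposite.unop_mul, MulOpposite.unop_mul]
    exact Connected.strictNested l (fun i hi => hc i (by simp [hi]))
      ((h.y_pow b).x_pow (polyOp_Y_pow_zero (hc b (by simp)) z) a)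

theorem connected_one (N : ℕ) : Connected N 1 (Pi.single 0 1) := by
  intro m _
  simp [Pi.single_apply, connector]

/-- The connector is 1 at `n = 0`, which links the constant 1 to the delta at 0, and is 1 at `m =
N`, so that the transform evaluated there is a plain sum. -/
theorem strictNested_exponents {k : List ℕ} (hk : ∀ i ∈ k, 0 < i) (h : k ≠ [] → 2 ≤ k.getLastD 0)
    (N : ℕ) : strictNested N (exponents k) 1 N = truncatedZeta k 0 N := by
  have h1 := (connected_one N).strictNested (exponents k) (isExponents_exponents k).2 N le_rfl
  rw [h1, ← sum_polySeq_word hk, partialSum_add_one_apply, exponents,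
    blockPoly_exponentsAux k 0 hk (fun _ => rfl) h, pow_zero, one_mul]
  refine Finset.sum_congr rfl fun n hn => ?_
  rw [connector_self (by rw [Finset.mem_range] at hn; omega), mul_one]
  rfl

/-! ### Comparison of the two iterated integrals -/

/-- The harmonic numbers. -/
noncomputable def harmonicSum (N : ℕ) : ℝ := ∑ q ∈ Finset.range (N + 1), recip q

theorem corecip_nonneg {N p : ℕ} (h : p ≤ N) : 0 ≤ corecip N p := by
  rw [corecip]
  have : (p : ℝ) ≤ N := by exact_mod_cast h
  exact div_nonneg zero_le_one (by linarith)

theorem corecip_le_corecip {N p q : ℕ} (h : p ≤ q) (hq : q < N) : corecip N p ≤ corecip N q := by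
  have h1 : (p : ℝ) ≤ q := by exact_mod_cast h
  have h2 : (q : ℝ) < N := by exact_mod_cast hq
  exact one_div_le_one_div_of_le (by linarith) (by linarith)

theorem sum_corecip (N : ℕ) : ∑ p ∈ Finset.range (N + 1), corecip N p = harmonicSum N := by
  rw [harmonicSum, ← Finset.sum_range_reflect]
  refine Finset.sum_congr rfl fun p hp => ?_
  rw [Finset.mem_range] at hp
  rw [corecip, recip, show N + 1 - 1 - p = N - p by omega, Nat.cast_sub (by omega)]
  simp

theorem sum_corecip_le {N m : ℕ} (h : m ≤ N) :
    ∑ p ∈ Finset.range (m + 1), corecip N p ≤ harmonicSum N := by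
  rw [← sum_corecip]
  exact Finset.sum_le_sum_of_subset_of_nonneg (Finset.range_mono (by omega)) fun p hp _ =>
    corecip_nonneg (by rw [Finset.mem_range] at hp; omega)

theorem sum_recip_le {N m : ℕ} (h : m ≤ N) :
    ∑ q ∈ Finset.range (m + 1), recip q ≤ harmonicSum N :=
  Finset.sum_le_sum_of_subset_of_nonneg (Finset.range_mono (by omega)) fun q _ _ => recip_nonneg q

theorem one_le_harmonicSum {N : ℕ} (hN : 1 ≤ N) : 1 ≤ harmonicSum N := by
  have h := Finset.single_le_sum (f := recip) (s := Finset.range (N + 1))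
    (fun q _ => recip_nonneg q) (Finset.mem_range.2 (by omega : 1 < N + 1))
  simpa [recip, harmonicSum] using h

theorem harmonicSum_nonneg (N : ℕ) : 0 ≤ harmonicSum N :=
  Finset.sum_nonneg fun q _ => recip_nonneg q

/-- A sum of terms `w j * f j` with `f ≤ c` is at most `c` times the sum of the weights. -/
theorem sum_mul_le {s : Finset ℕ} {w f : ℕ → ℝ} {c S : ℝ} (hw : ∀ j ∈ s, 0 ≤ w j)
    (hf : ∀ j ∈ s, f j ≤ c) (hc : 0 ≤ c) (hS : ∑ j ∈ s, w j ≤ S) : ∑ j ∈ s, w j * f j ≤ S * c := by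
  refine (Finset.sum_le_sum fun j hj => mul_le_mul_of_nonneg_left (hf j hj) (hw j hj)).trans ?_
  rw [← Finset.sum_mul]
  exact mul_le_mul_of_nonneg_right hS hc

/-- The functions `s ≤ g` are bounded by a power of the harmonic number, and their difference is of
lower order. -/
def Close (N k : ℕ) (C : ℝ) (g s : ℕ → ℝ) : Prop :=
  ∀ m ≤ N, 0 ≤ s m ∧ s m ≤ g m ∧ g m ≤ harmonicSum N ^ k ∧
    g m - s m ≤ C * harmonicSum N ^ k / (N + 1)

/-- A variant of `Close` inside a block of letters `y`. -/
def CloseAway (N k : ℕ) (C D : ℝ) (g s : ℕ → ℝ) : Prop :=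
  ∀ m ≤ N, 0 ≤ s m ∧ s m ≤ g m ∧ g m ≤ harmonicSum N ^ k ∧
    (m < N → g m - s m ≤ C * harmonicSum N ^ k / (N + 1) + D * harmonicSum N ^ k * corecip N m)

variable {N k : ℕ} {C D : ℝ} {g s : ℕ → ℝ}

theorem Close.closeAway (h : Close N k C g s) : CloseAway N k C 0 g s := fun m hm =>
  ⟨(h m hm).1, (h m hm).2.1, (h m hm).2.2.1, fun _ => by simpa using (h m hm).2.2.2⟩

/-- The extra diagonal term `p = m` raises `D` by one; earlier errors are controlled because
`1/(N-p)` increases with `p < N`. The case `m = N` is excluded since `corecip N N = 0`. -/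
theorem CloseAway.y (hN : 1 ≤ N) (hC : 0 ≤ C) (hD : 0 ≤ D) (h : CloseAway N k C D g s) :
    CloseAway N (k + 1) C (D + 1) (((partialSum + 1) * weight (corecip N)) g)
      ((partialSum * weight (corecip N)) s) := by
  intro m hm
  have hL := one_le_harmonicSum hN
  have hL0 := harmonicSum_nonneg N
  have hLk : 0 ≤ harmonicSum N ^ k := pow_nonneg hL0 k
  rw [Module.End.mul_apply, Module.End.mul_apply, partialSum_add_one_apply, partialSum_apply]
  simp only [weight_apply]
  have hc : ∀ p ∈ Finset.range (m + 1), 0 ≤ corecip N p := fun p hp =>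
    corecip_nonneg (by rw [Finset.mem_range] at hp; omega)
  have hp : ∀ p ∈ Finset.range (m + 1), p ≤ N := fun p hp => by rw [Finset.mem_range] at hp; omega
  have hsub : Finset.range m ⊆ Finset.range (m + 1) := Finset.range_mono (by omega)
  have hlast : 0 ≤ corecip N m * g m :=
    mul_nonneg (corecip_nonneg hm) ((h m hm).1.trans (h m hm).2.1)
  refine ⟨Finset.sum_nonneg fun p hp' => mul_nonneg (hc p (hsub hp')) (h p (hp p (hsub hp'))).1,
    ?_, ?_, fun hmN => ?_⟩
  · rw [Finset.sum_range_succ]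
    refine le_add_of_le_of_nonneg (Finset.sum_le_sum fun p hp' => ?_) hlast
    exact mul_le_mul_of_nonneg_left (h p (hp p (hsub hp'))).2.1 (hc p (hsub hp'))
  · rw [pow_succ']
    exact sum_mul_le hc (fun p hp' => (h p (hp p hp')).2.2.1) hLk (sum_corecip_le hm)
  · rw [Finset.sum_range_succ, add_sub_right_comm, ← Finset.sum_sub_distrib]
    simp only [← mul_sub]
    have hcm := corecip_nonneg hm
    have h1 : ∑ p ∈ Finset.range m, corecip N p * (g p - s p) ≤ harmonicSum N *
        (C * harmonicSum N ^ k / (N + 1) + D * harmonicSum N ^ k * corecip N m) := by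
      refine sum_mul_le (fun p hp' => hc p (hsub hp')) (fun p hp' => ?_) (by positivity) ?_
      · have hpm : p < m := Finset.mem_range.1 hp'
        refine ((h p (hp p (hsub hp'))).2.2.2 (by omega)).trans ?_
        gcongr
        exact corecip_le_corecip hpm.le hmN
      · exact (Finset.sum_le_sum_of_subset_of_nonneg hsub fun p hp' _ => hc p hp').trans
          (sum_corecip_le hm)
    have h2 : corecip N m * g m ≤ harmonicSum N ^ (k + 1) * corecip N m := by
      rw [mul_comm]
      refine mul_le_mul_of_nonneg_right ((h m hm).2.2.1.trans ?_) hcm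
      exact pow_le_pow_right₀ hL (Nat.le_succ k)
    refine (add_le_add h1 h2).trans_eq ?_
    ring

/-- The error `1/(N-j)` is summed against `1/(j+1)`. As `(j+1) + (N-j) = N+1`, partial fractions
bound this by `2 * harmonicSum N / (N + 1)`, which is the source of the constant `2 * D`. -/
theorem CloseAway.y_x (hC : 0 ≤ C) (hD : 0 ≤ D) (h : CloseAway N k C D g s) :
    Close N (k + 2) (C + 2 * D)
      (((partialSum + 1) * weight recip * (partialSum * weight (corecip N))) g)
      (((partialSum + 1) * weight recip * (partialSum * weight (corecip N))) s) := by
  intro m hm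
  have hL0 := harmonicSum_nonneg N
  have hLk : 0 ≤ harmonicSum N ^ k := pow_nonneg hL0 k
  simp only [Module.End.mul_apply]
  rw [partialSum_add_one_apply, partialSum_add_one_apply]
  simp only [weight_apply, partialSum_apply]
  have hc : ∀ q ≤ N, ∀ p ∈ Finset.range q, 0 ≤ corecip N p := fun q hq p hp =>
    corecip_nonneg (by rw [Finset.mem_range] at hp; omega)
  have hp : ∀ q ≤ N, ∀ p ∈ Finset.range q, p ≤ N := fun q hq p hp => by
    rw [Finset.mem_range] at hp; omega
  have hS : ∀ q ≤ N, ∑ p ∈ Finset.range q, corecip N p ≤ harmonicSum N := fun q hq => by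
    rcases q with _ | q
    · simpa using hL0
    · exact sum_corecip_le (by omega)
  have hq : ∀ q ∈ Finset.range (m + 1), q ≤ N := fun q hq => by rw [Finset.mem_range] at hq; omega
  refine ⟨Finset.sum_nonneg fun q hq' => mul_nonneg (recip_nonneg q)
    (Finset.sum_nonneg fun p hp' => mul_nonneg (hc q (hq q hq') p hp')
      (h p (hp q (hq q hq') p hp')).1),
    Finset.sum_le_sum fun q hq' => mul_le_mul_of_nonneg_left
      (Finset.sum_le_sum fun p hp' => mul_le_mul_of_nonneg_left
        (h p (hp q (hq q hq') p hp')).2.1 (hc q (hq q hq') p hp')) (recip_nonneg q), ?_, ?_⟩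
  · rw [pow_succ' _ (k + 1), pow_succ']
    refine sum_mul_le (fun q _ => recip_nonneg q) (fun q hq' => ?_) (by positivity)
      (sum_recip_le hm)
    exact sum_mul_le (hc q (hq q hq')) (fun p hp' => (h p (hp q (hq q hq') p hp')).2.2.1) hLk
      (hS q (hq q hq'))
  · rw [← Finset.sum_sub_distrib]
    simp only [← mul_sub, ← Finset.sum_sub_distrib]
    rw [Finset.sum_range_succ']
    have h0 : recip 0 = 0 := by simp [recip]
    rw [h0, zero_mul, add_zero]
    have h1 : ∀ j ∈ Finset.range m,
        ∑ p ∈ Finset.range (j + 1), corecip N p * (g p - s p) ≤ harmonicSum N *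
          (C * harmonicSum N ^ k / (N + 1) + D * harmonicSum N ^ k * corecip N j) := by
      intro j hj
      rw [Finset.mem_range] at hj
      have hcj := corecip_nonneg (N := N) (p := j) (by omega)
      refine sum_mul_le (hc (j + 1) (by omega)) (fun p hp' => ?_) (by positivity)
        (hS (j + 1) (by omega))
      rw [Finset.mem_range] at hp'
      refine ((h p (by omega)).2.2.2 (by omega)).trans ?_
      gcongr
      exact corecip_le_corecip (by omega) (by omega)
    have h2 : ∀ j ∈ Finset.range m, recip (j + 1) * corecip N j =
        (recip (j + 1) + corecip N j) / (N + 1) := by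
      intro j hj
      rw [Finset.mem_range] at hj
      have h3 : (N : ℝ) - j ≠ 0 := sub_ne_zero.2 (by exact_mod_cast (by omega : N ≠ j))
      have h4 : (j : ℝ) + 1 ≠ 0 := by positivity
      have h5 : (N : ℝ) + 1 ≠ 0 := by positivity
      rw [recip, corecip]
      push_cast
      field_simp
      ring
    have h6 : ∑ j ∈ Finset.range m, recip (j + 1) ≤ harmonicSum N := by
      refine le_trans ?_ (sum_recip_le hm)
      rw [Finset.sum_range_succ', h0, add_zero]
    have h7 : ∑ j ∈ Finset.range m, recip (j + 1) * corecip N j ≤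
        2 * harmonicSum N / (N + 1) := by
      rw [Finset.sum_congr rfl h2, ← Finset.sum_div, Finset.sum_add_distrib]
      have := hS m hm
      gcongr
      linarith
    calc ∑ j ∈ Finset.range m, recip (j + 1) *
          ∑ p ∈ Finset.range (j + 1), corecip N p * (g p - s p)
        ≤ ∑ j ∈ Finset.range m, recip (j + 1) * (harmonicSum N *
          (C * harmonicSum N ^ k / (N + 1) + D * harmonicSum N ^ k * corecip N j)) :=
        Finset.sum_le_sum fun j hj => mul_le_mul_of_nonneg_left (h1 j hj) (recip_nonneg _)
      _ = (∑ j ∈ Finset.range m, recip (j + 1)) *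
            (harmonicSum N * (C * harmonicSum N ^ k / (N + 1))) +
          (∑ j ∈ Finset.range m, recip (j + 1) * corecip N j) *
            (harmonicSum N * (D * harmonicSum N ^ k)) := by
        rw [Finset.sum_mul, Finset.sum_mul, ← Finset.sum_add_distrib]
        exact Finset.sum_congr rfl fun _ _ => by ring
      _ ≤ harmonicSum N * (harmonicSum N * (C * harmonicSum N ^ k / (N + 1))) +
          2 * harmonicSum N / (N + 1) * (harmonicSum N * (D * harmonicSum N ^ k)) := by
        gcongr
      _ = (C + 2 * D) * harmonicSum N ^ (k + 2) / (N + 1) := by ring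

theorem Close.x (hC : 0 ≤ C) (h : Close N k C g s) :
    Close N (k + 1) C (((partialSum + 1) * weight recip) g)
      (((partialSum + 1) * weight recip) s) := by
  intro m hm
  have hLk : 0 ≤ harmonicSum N ^ k := pow_nonneg (harmonicSum_nonneg N) k
  rw [Module.End.mul_apply, Module.End.mul_apply, partialSum_add_one_apply,
    partialSum_add_one_apply]
  simp only [weight_apply]
  have hq : ∀ q ∈ Finset.range (m + 1), q ≤ N := fun q hq => by rw [Finset.mem_range] at hq; omega
  refine ⟨Finset.sum_nonneg fun q hq' => mul_nonneg (recip_nonneg q) (h q (hq q hq')).1,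
    Finset.sum_le_sum fun q hq' =>
      mul_le_mul_of_nonneg_left (h q (hq q hq')).2.1 (recip_nonneg q), ?_, ?_⟩
  · rw [pow_succ']
    exact sum_mul_le (fun q _ => recip_nonneg q) (fun q hq' => (h q (hq q hq')).2.2.1) hLk
      (sum_recip_le hm)
  · rw [← Finset.sum_sub_distrib]
    simp only [← mul_sub]
    refine (sum_mul_le (fun q _ => recip_nonneg q) (fun q hq' => (h q (hq q hq')).2.2.2)
      (by positivity) (sum_recip_le hm)).trans_eq ?_
    ring

theorem CloseAway.y_pow (hN : 1 ≤ N) (hC : 0 ≤ C) (h : CloseAway N k C 0 g s) (b : ℕ) :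
    CloseAway N (k + b) C b ((((partialSum + 1) * weight (corecip N)) ^ b) g)
      (((partialSum * weight (corecip N)) ^ b) s) := by
  induction b with
  | zero => simpa using h
  | succ b ih =>
    rw [pow_succ', pow_succ', Nat.cast_succ]
    exact ih.y hN hC b.cast_nonneg

theorem Close.x_pow (hC : 0 ≤ C) (h : Close N k C g s) (a : ℕ) :
    Close N (k + a) C ((((partialSum + 1) * weight recip) ^ a) g)
      ((((partialSum + 1) * weight recip) ^ a) s) := by
  induction a with
  | zero => simpa using h
  | succ a ih =>
    rw [pow_succ']
    exact ih.x hC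

theorem mul_block_succ {A : Type*} [Ring A] (σ w : A) (b : ℕ) :
    σ * block σ w (b + 1) = σ * w * ((σ + 1) * w) ^ b := by
  induction b with
  | zero => simp [block_one]
  | succ b ih =>
    rw [block_succ', pow_succ, ← mul_assoc (σ * w), ← ih]
    simp only [mul_assoc]

theorem add_one_mul_block_succ {A : Type*} [Ring A] (σ w : A) (b : ℕ) :
    (σ + 1) * block σ w (b + 1) = ((σ + 1) * w) ^ (b + 1) := by
  induction b with
  | zero => simp [block_one]
  | succ b ih =>
    rw [block_succ', pow_succ, ← ih]
    simp only [mul_assoc]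

/-- The outermost summation of the `1/(N-p)` run is strict on both sides, so only `b - 1`
inequalities differ. -/
theorem Close.pair (hN : 1 ≤ N) (hC : 0 ≤ C) (h : Close N k C g s) {a b : ℕ} (ha : 1 ≤ a)
    (hb : 1 ≤ b) :
    Close N (k + (b + a)) (C + 2 * (b - 1 : ℕ))
      (((partialSum + 1) * block partialSum (weight recip) a *
        (partialSum * block partialSum (weight (corecip N)) b)) g)
      ((((partialSum + 1) * weight recip) ^ a * (partialSum * weight (corecip N)) ^ b) s) := by
  obtain ⟨a, rfl⟩ := Nat.exists_eq_add_of_le' ha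
  obtain ⟨b, rfl⟩ := Nat.exists_eq_add_of_le' hb
  rw [mul_block_succ, add_one_mul_block_succ, pow_succ _ a, pow_succ' _ b]
  have := ((h.closeAway.y_pow hN hC b).y_x hC b.cast_nonneg).x_pow (by positivity) a
  rw [show k + b + 2 + a = k + (b + 1 + (a + 1)) by ring] at this
  simpa only [Module.End.mul_apply, Nat.add_sub_cancel] using this

theorem exists_close : ∀ (c : List ℕ), IsExponents c → ∀ (k : ℕ) (C : ℝ), 0 ≤ C → ∃ C' : ℝ,
    ∀ N : ℕ, 1 ≤ N → ∀ g s : ℕ → ℝ, Close N k C g s →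
      Close N (k + c.sum) C' (nested N c g) (strictNested N c s)
  | [], _, _, C, _ => ⟨C, fun _ _ _ _ h => h⟩
  | [_], h, _, _, _ => by simp [IsExponents] at h
  | b :: a :: l, hc, k, C, hC => by
    obtain ⟨C', hC'⟩ := exists_close l
      ⟨by simpa [Nat.even_add_one] using hc.1, fun i hi => hc.2 i (by simp [hi])⟩
      (k + (b + a)) (C + 2 * (b - 1 : ℕ)) (by positivity)
    refine ⟨C', fun N hN g s h => ?_⟩
    have := hC' N hN _ _ (h.pair hN hC (hc.2 a (by simp)) (hc.2 b (by simp)))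
    rwa [show k + (b + a) + l.sum = k + (b :: a :: l).sum by simp; ring] at this

theorem harmonicSum_le (N : ℕ) : harmonicSum N ≤ 1 + Real.log N := by
  refine le_trans (le_of_eq ?_) (harmonic_le_one_add_log N)
  rw [harmonicSum, Finset.sum_range_succ', harmonic]
  simp [recip]

theorem tendsto_harmonicSum_pow_div (C : ℝ) (k : ℕ) :
    Tendsto (fun N : ℕ => C * harmonicSum N ^ k / (N + 1)) atTop (𝓝 0) := by
  have h1 : Tendsto (fun x : ℝ => Real.log x ^ k / x) atTop (𝓝 0) :=
    (Real.isLittleO_pow_log_id_atTop (n := k)).tendsto_div_nhds_zero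
  -- Substituting `x = e N` makes `log x` equal to `1 + log N`, the bound for the harmonic sum.
  have h2 : Tendsto (fun N : ℕ => Real.exp 1 * (N : ℝ)) atTop atTop :=
    tendsto_natCast_atTop_atTop.const_mul_atTop (Real.exp_pos 1)
  have h3 := (h1.comp h2).const_mul (Real.exp 1)
  rw [mul_zero] at h3
  have h4 : Tendsto (fun N : ℕ => harmonicSum N ^ k / (N + 1)) atTop (𝓝 0) := by
    refine squeeze_zero' (Eventually.of_forall fun N => ?_) ?_ h3
    · have := pow_nonneg (harmonicSum_nonneg N) k
      positivity
    · filter_upwards [eventually_ge_atTop 1] with N hN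
      have hN' : (0 : ℝ) < N := by exact_mod_cast hN
      have h5 : Real.log (Real.exp 1 * N) = 1 + Real.log N := by
        rw [Real.log_mul (Real.exp_pos 1).ne' hN'.ne', Real.log_exp]
      have h6 : 0 ≤ 1 + Real.log N := (harmonicSum_nonneg N).trans (harmonicSum_le N)
      simp only [Function.comp, h5]
      rw [mul_div_assoc', mul_div_mul_left _ _ (Real.exp_pos 1).ne']
      have := pow_le_pow_left₀ (harmonicSum_nonneg N) (harmonicSum_le N) k
      gcongr
      linarith
  simpa [mul_div_assoc] using h4.const_mul C

theorem tendsto_discreteIntegral {k : List ℕ} (hk : ∀ i ∈ k, 0 < i) (h : 2 ≤ k.getLastD 0) :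
    Tendsto (fun N => discreteIntegral N (exponents k)) atTop (𝓝 (zeta k)) := by
  obtain ⟨C, hC⟩ := exists_close (exponents k) (isExponents_exponents k) 0 0 le_rfl
  have h1 : ∀ N, 1 ≤ N → truncatedZeta k 0 N ≤ discreteIntegral N (exponents k) ∧
      discreteIntegral N (exponents k) ≤ truncatedZeta k 0 N +
        C * harmonicSum N ^ (0 + (exponents k).sum) / (N + 1) := by
    intro N hN
    have h2 := hC N hN 1 1 (fun m _ => by simp) N le_rfl
    rw [strictNested_exponents hk fun _ => h] at h2
    exact ⟨h2.2.1, by have := h2.2.2.2; rw [discreteIntegral]; linarith⟩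
  have h3 := (tendsto_truncatedZeta hk h).add
    (tendsto_harmonicSum_pow_div C (0 + (exponents k).sum))
  rw [add_zero] at h3
  refine tendsto_of_tendsto_of_tendsto_of_le_of_le' (tendsto_truncatedZeta hk h) h3 ?_ ?_
  · filter_upwards [eventually_ge_atTop 1] with N hN using (h1 N hN).1
  · filter_upwards [eventually_ge_atTop 1] with N hN using (h1 N hN).2

theorem sum_polySeq_sum_zsmul {ι : Type*} (n : ℕ) (s : Finset ι) (a : ι → ℤ) (p : ι → Poly) :
    (partialSum + 1) (polySeq (∑ i ∈ s, a i • p i)) n =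
      ∑ i ∈ s, a i • (partialSum + 1) (polySeq (p i)) n := by
  let φ : Poly →+ ℝ := AddMonoidHom.mk' (fun p => (partialSum + 1) (polySeq p) n) fun p q => by
    have : polySeq (p + q) = polySeq p + polySeq q := funext fun m => polySeq_add p q m
    rw [this, map_add, Pi.add_apply]
  exact (map_sum φ _ s).trans (Finset.sum_congr rfl fun i _ => map_zsmul φ (a i) (p i))

end MZV

theorem theorem1p5 (k : ℕ) (hk : 2 ≤ k) :
    -- the series defining the multiple zeta values of weight `k` converge
    (∀ κ ∈ MZV.admissible k, Summable (MZV.term κ.blocks)) ∧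
    -- the integers `c_{κ;l}` are exactly the coefficients of the polynomial `𝔇` attached to `κ`
    (∀ κ ∈ MZV.admissible k,
      MZV.frakD (MZV.exponents κ.blocks) =
        ∑ l ∈ MZV.geTwo k,
          MZV.mzvCoeff κ.blocks l.blocks • FreeAbelianGroup.of (MZV.word l.blocks)) ∧
    -- the expansion of each multiple zeta value
    (∀ κ ∈ MZV.admissible k,
      MZV.zeta κ.blocks =
        ∑ l ∈ MZV.geTwo k, (MZV.mzvCoeff κ.blocks l.blocks : ℝ) * MZV.zeta l.blocks) ∧
    -- the equality of the two spans
    Submodule.span ℤ ((fun κ : Composition k => MZV.zeta κ.blocks) '' (MZV.admissible k : Set _)) =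
      Submodule.span ℤ ((fun κ : Composition k => MZV.zeta κ.blocks) '' (MZV.geTwo k : Set _)) := by
  have hpos (κ : Composition k) : ∀ i ∈ κ.blocks, 0 < i := fun i hi => κ.blocks_pos hi
  have hadm : ∀ κ ∈ MZV.admissible k, 2 ≤ κ.blocks.getLastD 0 := fun κ hκ =>
    (Finset.mem_filter.1 hκ).2
  have hsub : MZV.geTwo k ⊆ MZV.admissible k := Finset.filter_subset _ _
  have hD : ∀ κ ∈ MZV.admissible k, MZV.frakD (MZV.exponents κ.blocks) =
      ∑ l ∈ MZV.geTwo k, MZV.mzvCoeff κ.blocks l.blocks • MZV.monomial (MZV.word l.blocks) := by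
    intro κ hκ
    have h1 := MZV.frakD_mem_closure _ _ rfl (MZV.isExponents_exponents κ.blocks)
    rw [MZV.exponents, MZV.sum_exponentsAux κ.blocks 0 (hpos κ) (fun _ => rfl)
      (fun _ => hadm κ hκ), zero_add,
      κ.blocks_sum] at h1
    exact MZV.eq_sum_coeff (by omega) h1
  have hzeta : ∀ κ ∈ MZV.admissible k, MZV.zeta κ.blocks =
      ∑ l ∈ MZV.geTwo k, (MZV.mzvCoeff κ.blocks l.blocks : ℝ) * MZV.zeta l.blocks := by
    intro κ hκ
    -- The expansion already holds at every finite level `n`; both sides then pass to the limit.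
    refine tendsto_nhds_unique (MZV.tendsto_discreteIntegral (hpos κ) (hadm κ hκ)) ?_
    have h1 : ∀ n, MZV.discreteIntegral n (MZV.exponents κ.blocks) =
        ∑ l ∈ MZV.geTwo k,
          (MZV.mzvCoeff κ.blocks l.blocks : ℝ) * MZV.truncatedZeta l.blocks 0 n := by
      intro n
      rw [← MZV.truncated_eq_discreteIntegral n _ (MZV.isExponents_exponents κ.blocks),
        MZV.truncated, hD κ hκ]
      simp only [← MZV.sum_polySeq_word (hpos _), ← zsmul_eq_mul]
      exact MZV.sum_polySeq_sum_zsmul n _ _ _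
    simp only [h1]
    exact tendsto_finsetSum _ fun l hl =>
      (MZV.tendsto_truncatedZeta (hpos l) (hadm l (hsub hl))).const_mul _
  refine ⟨fun κ hκ => MZV.summable_term (hpos κ) (hadm κ hκ), hD, hzeta, le_antisymm ?_ ?_⟩
  · rw [Submodule.span_le]
    rintro _ ⟨κ, hκ, rfl⟩
    simp only [hzeta κ hκ]
    refine Submodule.sum_mem _ fun l hl => ?_
    rw [← zsmul_eq_mul]
    exact Submodule.smul_mem _ _ (Submodule.subset_span ⟨l, hl, rfl⟩)
  · exact Submodule.span_mono (Set.image_mono (by exact_mod_cast hsub))
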